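/- Let $\mathcal G=(V,\mathcal E)$ be a connected, locally finite simple graph with countable vertex set, let $(a_{x,y})_{\{x,y\}\in\mathcal E}$ be symmetric positive conductances, put $a_x=\sum_{z\sim x}a_{x,z}$, and let $X$ be the Markov chain on $V$ with $p_{x,y}=a_{x,y}/a_x$ if $x\sim y$ and $p_{x,y}=0$ otherwise, with law $P_x$ when started from $x$. Assume that $X$ is transient. Let $W$ be the set of nearest-neighbour trajectories $(w_n)_{n\in\mathbb Z}$ that visit every vertex finitely often, with the $\sigma$-algebra generated by the coordinates, let $W^*$ be its quotient by time shifts, with the quotient $\sigma$-algebra $\mathcal W^*$, and $\pi^*:W\to W^*$ the projection. For finite $K\subset V$ let $W_K\subset W$ be the set of trajectories that visit $K$, and $W_K^*=\pi^*(W_K)$. With $\tau_K^+=\inf\{n\ge1: X_n\in K\}$ and $e_K(x)=a_xP_x[\tau_K^+=\infty]$ for $x\in K$, $e_K(x)=0$ for $x\notin K$, let $\nu_K$ be the measure on $W$ given by $$\nu_K\big((w_{-n})_{n\ge0}\in A,\ w_0=x,\ (w_n)_{n\ge0}\in B\big)=P_x[A\mid\tau_K^+=\infty]\,e_K(x)\,P_x[B],$$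 and let $\nu$ be the measure on $W^*$ whose restriction to $W_K^*$ is $\nu_K\circ(\pi^*)^{-1}$ for every finite $K$. Let $\Omega$ be the set of at most countable sums $\omega=\sum_i\delta_{w_i^*}$ of point masses on $W^*$ with $\omega(W_K^*)<\infty$ for all finite $K$, with the $\sigma$-algebra generated by the maps $\omega\mapsto\omega(D)$, $D\in\mathcal W^*$, and the order: $\omega\le\omega'$ if and only if $\omega(D)\le\omega'(D)$ for all $D\in\mathcal W^*$. The interlacement law $\mathbb P$ is the law on $\Omega$ of a Poisson point process with intensity $\nu$. For finite $K\subset V$ and $w\in W_K$ let $\tau_K(w)$ and $\lambda_K(w)$ be the first and the last time at which $w$ is in $K$, and put $$\mathrm{Out}_{\to K}(w)=(w_{\tau_K(w)+n})_{n\le0},\qquad \mathrm{Out}_{K\to}(w)=(w_{\lambda_K(w)+n})_{n\ge0}.$$ For $\omega=\sum_i\delta_{w_i^*}\in\Omega$, with $w_i$ any representative of $w_i^*$, let $$\widetilde{\mathrm{Out}}_K(\omega)=\sum_{i:\,w_i^*\in W_K^*}\delta_{\mathrm{Out}_{\to K}(w_i)}+\sum_{i:\,w_i^*\in W_K^*}\delta_{\mathrm{Out}_{K\to}(w_i)}+\sum_{i:\,w_i^*\notin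 W_K^*}\delta_{w_i^*},$$ a point measure on the disjoint union of the spaces of incoming pieces, of outgoing pieces, and $W^*$, and let $\widetilde{\mathcal T}_{RI}=\bigcap_{K}\sigma(\widetilde{\mathrm{Out}}_K)$, the intersection being over all finite $K\subset V$. Then every increasing event $E\in\widetilde{\mathcal T}_{RI}$ (that is, $\omega\in E$ and $\omega\le\omega'$ imply $\omega'\in E$) satisfies $\mathbb P(E)\in\{0,1\}$. -/

import Mathlib

open MeasureTheory ProbabilityTheory
open scoped ENNReal NNReal

namespace Interlacement

noncomputable section

/-! ### The reversible Markov chain of a weighted graph -/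

section Chain

variable {V : Type*} (G : SimpleGraph V) [G.LocallyFinite] (a : V → V → ℝ≥0)

/-- The total conductance `a_x = ∑_{z ∼ x} a_{x,z}` at a vertex. -/
def totalWeight (x : V) : ℝ≥0 := ∑ z ∈ G.neighborFinset x, a x z

variable [MeasurableSpace V] [DiscreteMeasurableSpace V]

open Classical in
/-- The transition kernel `p_{x,y} = a_{x,y} / a_x` for `y ∼ x`, and `0` for other `y`.
(If `a_x = 0`, which for positive conductances on a connected graph happens only when `x` is the
only vertex, the chain stays put; it is then not transient.) -/
def step : Kernel V V where
  toFun x :=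
    if totalWeight G a x = 0 then Measure.dirac x
    else ∑ y ∈ G.neighborFinset x,
      ((a x y : ℝ≥0∞) / (totalWeight G a x : ℝ≥0∞)) • Measure.dirac y
  measurable' := Measurable.of_discrete

instance : IsMarkovKernel (step G a) := by
  classical
  refine ⟨fun x => ⟨?_⟩⟩
  by_cases h : totalWeight G a x = 0
  · simp [step, h]
  · have h' : (totalWeight G a x : ℝ≥0∞) ≠ 0 := by exact_mod_cast h
    simp only [step, Kernel.coe_mk, h, if_false, Measure.coe_finsetSum, Finset.sum_apply,
      Measure.smul_apply, measure_univ, smul_eq_mul, mul_one, div_eq_mul_inv]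
    rw [← Finset.sum_mul, ← ENNReal.ofNNReal_finsetSum]
    exact ENNReal.mul_inv_cancel h' ENNReal.coe_ne_top

/-- The law `P_x` of the chain started from `x`, as a measure on the space of sequences
`ℕ → V`. -/
def walkLaw (x : V) : Measure (ℕ → V) :=
  Kernel.traj (X := fun _ => V)
    (fun n => (step G a).comap (fun h : (i : Finset.Iic n) → V => h ⟨n, Finset.mem_Iic.2 le_rfl⟩)
      (measurable_pi_apply _)) 0 (fun _ => x)

/-- The chain is transient: started from any vertex, it almost surely visits this vertex only
finitely many times. -/
def IsTransient : Prop :=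
  ∀ x : V, ∀ᵐ w ∂(walkLaw G a x), {n : ℕ | w n = x}.Finite

/-- The event `{τ_K^+ = ∞}` that a path does not visit `K` at times `n ≥ 1`. -/
def noReturn (K : Finset V) : Set (ℕ → V) := {w | ∀ n, 1 ≤ n → w n ∉ K}

/-- The equilibrium measure `e_K(x) = a_x P_x[τ_K^+ = ∞]` at a point `x ∈ K`. -/
def equilibrium (K : Finset V) (x : V) : ℝ≥0∞ :=
  (totalWeight G a x : ℝ≥0∞) * walkLaw G a x (noReturn K)

end Chain

/-! ### Biinfinite trajectories, and trajectories up to time shift -/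

section Trajectories

variable {V : Type*} (G : SimpleGraph V)

/-- The space `W` of transient nearest-neighbour trajectories indexed by `ℤ`, with the σ-algebra
generated by the coordinate maps. -/
abbrev Traj : Type _ :=
  {w : ℤ → V // (∀ n, G.Adj (w n) (w (n + 1))) ∧ ∀ x, {n : ℤ | w n = x}.Finite}

/-- Two trajectories are equivalent if they differ by a time shift. -/
def shiftSetoid : Setoid (Traj G) where
  r w w' := ∃ k : ℤ, ∀ n, w.1 (n + k) = w'.1 n
  iseqv :=
    { refl := fun w => ⟨0, fun n => by simp⟩
      symm := fun {w w'} ⟨k, hk⟩ => ⟨-k, fun n => by rw [← hk, neg_add_cancel_right]⟩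
      trans := fun {w w' w''} ⟨k, hk⟩ ⟨l, hl⟩ =>
        ⟨l + k, fun n => by rw [← hl, ← hk, add_assoc]⟩ }

/-- The space `W^*` of trajectories up to time shift, with the quotient σ-algebra: `D` is measurable
iff its preimage in `W` is. -/
abbrev TrajMod : Type _ := Quotient (shiftSetoid G)

variable {G}

/-- The projection `π^* : W → W^*`. -/
def proj (w : Traj G) : TrajMod G := Quotient.mk (shiftSetoid G) w

/-- The trajectory `w` visits `K`, i.e. `w ∈ W_K`. -/
def Hits (K : Finset V) (w : Traj G) : Prop := ∃ n, w.1 n ∈ K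

variable (G) in
/-- The set `W_K^*` of trajectories up to time shift that visit `K`. -/
def hitSet (K : Finset V) : Set (TrajMod G) := proj '' {w | Hits K w}

/-- The hitting time `τ_K(w)` (meaningful for `w ∈ W_K`). -/
def hitTime (K : Finset V) (w : Traj G) : ℤ := sInf {n : ℤ | w.1 n ∈ K}

/-- The time `λ_K(w)` of the last visit to `K` (meaningful for `w ∈ W_K`). -/
def lastTime (K : Finset V) (w : Traj G) : ℤ := sSup {n : ℤ | w.1 n ∈ K}

/-- The incoming piece `(w_{τ_K(w) + n})_{n ≤ 0}`, a sequence indexed by the nonpositive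
integers; its entry with index `-n` is stored at `n : ℕ`. -/
def outIn (K : Finset V) (w : Traj G) : ℕ → V := fun n => w.1 (hitTime K w - n)

/-- The outgoing piece `(w_{λ_K(w) + n})_{n ≥ 0}`. -/
def outOut (K : Finset V) (w : Traj G) : ℕ → V := fun n => w.1 (lastTime K w + n)

lemma visits_finite (K : Finset V) (w : Traj G) : {n : ℤ | w.1 n ∈ K}.Finite := by
  have : {n : ℤ | w.1 n ∈ K} = ⋃ x ∈ K, {n : ℤ | w.1 n = x} := by ext n; simp
  rw [this]
  exact K.finite_toSet.biUnion fun x _ => w.2.2 x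

lemma visits_shift {K : Finset V} {w w' : Traj G} {k : ℤ}
    (hk : ∀ n, w.1 (n + k) = w'.1 n) :
    {n : ℤ | w.1 n ∈ K} = (OrderIso.addRight k) '' {n : ℤ | w'.1 n ∈ K} := by
  ext n
  simp only [Set.mem_ofPred_eq, Set.mem_image, OrderIso.addRight_apply]
  constructor
  · intro h
    exact ⟨n - k, by rw [← hk]; simpa using h, by ring⟩
  · rintro ⟨m, hm, rfl⟩
    rwa [hk]

lemma hits_shift {K : Finset V} {w w' : Traj G} {k : ℤ}
    (hk : ∀ n, w.1 (n + k) = w'.1 n) : Hits K w ↔ Hits K w' := by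
  constructor
  · rintro ⟨n, hn⟩
    exact ⟨n - k, by rw [← hk]; simpa using hn⟩
  · rintro ⟨n, hn⟩
    exact ⟨n + k, by rwa [hk]⟩

lemma outIn_shift {K : Finset V} {w w' : Traj G} {k : ℤ}
    (hk : ∀ n, w.1 (n + k) = w'.1 n) (h : Hits K w') : outIn K w = outIn K w' := by
  have h1 : hitTime K w = hitTime K w' + k := by
    rw [hitTime, visits_shift hk,
      ← (OrderIso.addRight k).map_csInf' (show {n : ℤ | w'.1 n ∈ K}.Nonempty from h)
        (visits_finite K w').bddBelow]
    rfl
  funext n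
  rw [outIn, outIn, h1, ← hk, add_sub_right_comm]

lemma outOut_shift {K : Finset V} {w w' : Traj G} {k : ℤ}
    (hk : ∀ n, w.1 (n + k) = w'.1 n) (h : Hits K w') : outOut K w = outOut K w' := by
  have h1 : lastTime K w = lastTime K w' + k := by
    rw [lastTime, visits_shift hk,
      ← (OrderIso.addRight k).map_csSup' (show {n : ℤ | w'.1 n ∈ K}.Nonempty from h)
        (visits_finite K w').bddAbove]
    rfl
  funext n
  rw [outOut, outOut, h1, ← hk, add_right_comm]

end Trajectories

/-! ### The intensity measure -/

section Intensity

variable {V : Type*}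

/-- The biinfinite sequence equal to `p.1` read backwards at nonpositive times and to `p.2` at
positive times. -/
def glue (p : (ℕ → V) × (ℕ → V)) : ℤ → V :=
  fun n => if n ≤ 0 then p.1 (-n).toNat else p.2 n.toNat

variable (G : SimpleGraph V) [G.LocallyFinite] (a : V → V → ℝ≥0)
  [MeasurableSpace V] [DiscreteMeasurableSpace V]

/-- The measure `ν_K` on `W`: it gives to `{(w_{-n})_{n ≥ 0} ∈ A, w_0 = x, (w_n)_{n ≥ 0} ∈ B}` the
mass `P_x[A | τ_K^+ = ∞] e_K(x) P_x[B]` if `x ∈ K`, and mass `0` if `x ∉ K`. It is first built on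
all sequences `ℤ → V`, then restricted to `W`, where it lives when the chain is transient. -/
def nuOn (K : Finset V) : Measure (Traj G) :=
  (∑ x ∈ K, equilibrium G a K x •
    (((cond (walkLaw G a x) (noReturn K)).prod (walkLaw G a x)).map glue)).comap Subtype.val

/-- The intensity measure `ν` on `W^*`. The measures `ν_K ∘ (π^*)⁻¹` increase with `K`, since
`ν_K ∘ (π^*)⁻¹` is the restriction of `ν_L ∘ (π^*)⁻¹` to `W_K^*` whenever `K ⊆ L`; hence their
supremum `ν` is the measure whose restriction to `W_K^*` is `ν_K ∘ (π^*)⁻¹` for every `K`. -/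
def nu : Measure (TrajMod G) := ⨆ K : Finset V, (nuOn G a K).map proj

end Intensity

/-! ### Poisson point processes and the interlacement law -/

/-- Under `P`, the random measure `ξ` is a Poisson point process with intensity `μ`: `ξ(D)` has the
Poisson law of parameter `μ(D)` (and is a.s. infinite if `μ(D) = ∞`), and the random variables
`ξ(D_1), …, ξ(D_m)` are independent if the `D_i` are pairwise disjoint. -/
structure IsPoissonPointProcess {S X : Type*} [MeasurableSpace S] [MeasurableSpace X]
    (μ : Measure X) (ξ : S → Measure X) (P : Measure S) : Prop where
  isProbabilityMeasure : IsProbabilityMeasure P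
  measurable : Measurable ξ
  poisson : ∀ D : Set X, MeasurableSet D → μ D ≠ ∞ →
    P.map (fun s => ξ s D) = (poissonMeasure (μ D).toNNReal).map (fun k : ℕ => (k : ℝ≥0∞))
  infinite : ∀ D : Set X, MeasurableSet D → μ D = ∞ → ∀ᵐ s ∂P, ξ s D = ∞
  indep : ∀ (m : ℕ) (D : Fin m → Set X), (∀ i, MeasurableSet (D i)) →
    Pairwise (Function.onFun Disjoint D) → iIndepFun (fun i s => ξ s (D i)) P

section Config

variable {V : Type*} (G : SimpleGraph V) [MeasurableSpace V]

/-- The space `Ω` of point measures `ω = ∑_i δ_{w_i^*}` on `W^*`, with at most countably many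
points, such that `ω(W_K^*) < ∞` for every finite `K`. Its σ-algebra is the one generated by the maps
`ω ↦ ω(D)` for measurable `D`, and its order is: `ω ≤ ω'` iff `ω(D) ≤ ω'(D)` for every
measurable `D` (both are those of `Measure`, restricted to this subtype). -/
abbrev Config : Type _ :=
  {ω : Measure (TrajMod G) //
    (∃ (I : Set ℕ) (w : I → TrajMod G), ω = Measure.sum fun i => Measure.dirac (w i)) ∧
    ∀ K : Finset V, ω (hitSet G K) < ∞}

/-- `P` is the interlacement law: the law on `Ω` of a Poisson point process with intensity `ν`. -/
def IsInterlacementLaw [DiscreteMeasurableSpace V] [G.LocallyFinite] (a : V → V → ℝ≥0)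
    (P : Measure (Config G)) : Prop :=
  IsPoissonPointProcess (nu G a) (fun ω : Config G => ω.1) P

/-! ### The trace outside a finite set without pairing, and the non-local σ-algebra -/

/-- The disjoint union of the spaces of incoming pieces, of outgoing pieces, and of complete
trajectories up to time shift. -/
abbrev Pieces : Type _ := (ℕ → V) ⊕ ((ℕ → V) ⊕ TrajMod G)

variable {G}

open Classical in
/-- The contribution of one trajectory to the trace outside `K`: a point mass at its incoming piece
plus a point mass at its outgoing piece if it visits `K`, a point mass at the trajectory up to time
shift otherwise. -/
def tracePieces (K : Finset V) (w : Traj G) : Measure (Pieces G) :=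
  if Hits K w then
    Measure.dirac (Sum.inl (outIn K w)) + Measure.dirac (Sum.inr (Sum.inl (outOut K w)))
  else Measure.dirac (Sum.inr (Sum.inr (proj w)))

/-- The contribution of a trajectory up to time shift; any representative gives the same. -/
def tracePiecesMod (K : Finset V) : TrajMod G → Measure (Pieces G) :=
  Quotient.lift (tracePieces K) (by
    rintro w w' ⟨k, hk⟩
    have hp : proj w = proj w' := Quotient.sound (s := shiftSetoid G) ⟨k, hk⟩
    by_cases h : Hits K w'
    · simp only [tracePieces, hits_shift hk, h, if_true, outIn_shift hk h, outOut_shift hk h]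
    · simp only [tracePieces, hits_shift hk, h, if_false, hp])

/-- The trace of `ω = ∑_i δ_{w_i^*}` outside `K` without pairing: the sum over `i` of the
contributions of the `w_i^*`. -/
def outUnpaired (K : Finset V) (ω : Config G) : Measure (Pieces G) :=
  ω.1.bind (tracePiecesMod K)

variable (G) in
/-- The σ-algebra of the non-local events that forget the pairing: the intersection, over all finite
`K`, of the σ-algebras generated by the traces outside `K` without pairing. -/
@[reducible] def unpairedTail : MeasurableSpace (Config G) :=
  ⨅ K : Finset V, MeasurableSpace.comap (outUnpaired K) inferInstance

end Config

end

end Interlacement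

set_option linter.unusedSectionVars false

/-! The heart of the matter is that inserting one more trajectory through a vertex `o` into the
interlacement does not raise the probability of `E`. Write the inserted two-sided walk through `o`
as a past that follows `b` for `n` steps and then `α`, and a future that follows `c` for `n` steps
and then `β`. Let `α'` and `β'` be further independent continuations from `b n` and `c n`. Since `E`
is increasing, it is preserved on adding also the trajectory with past through `c` and `β'`, and
future through `b` and `α'`. Outside a finite set containing the endpoints of `b` and `c`, the
unpaired traces of these two trajectories are those of `(α, α')` and `(β', β)`. As `E` does not see
the pairing, adding the walk through `o` is at most as favourable to `E` as adding two independent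
trajectories, each a two-sided walk through the position at time `n` of a walk from `o`
(`tracePieces_add_eq`, `lintegral_classLaw_le`).

For large `n` such a far trajectory is undetectable. Its law `mixLaw` has a density `r` with respect
to the intensity `ν`, bounded by an explicit sum of visit counts, and `∫ r² dν` is at most a
constant times the tail from time `2n` of the Green series at `o`, which tends to zero by transience
(`mixLaw_le`, `lintegral_mixDensity_le`). By the Mecke equation, inserting an independent point of
density `r` reweights the Poisson law by `Y(ω) = ∫ r dω`, which has mean `1` and variance `∫ r² dν`.
Hence the insertion changes probabilities by little (`lintegral_addPt_le`); two applications and `n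
→ ∞` give `lintegral_classLaw_addPt_le`.

Monotonicity turns this inequality of probabilities into almost sure invariance of `E` under the
insertion of a walk through any `o`, and so, since `ν` is absolutely continuous with respect to
these walks (`nu_eq_zero`), under the insertion of `ν`-almost every trajectory. A Poisson process
has no nontrivial event with this invariance: conditioning on such an event leaves the recursion for
the counts intact, so the event is independent of itself (`zero_one_of_addPt`). -/

namespace Interlacement

noncomputable section

/-! ### Laws on sequence space -/

section Sequences

variable {V : Type*}

/-- The sequences that agree with `v` up to time `n`. -/
def cyl (v : ℕ → V) (n : ℕ) : Set (ℕ → V) := {w | ∀ i ≤ n, w i = v i}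

lemma cyl_zero (v : ℕ → V) : cyl v 0 = {w | w 0 = v 0} := by ext w; simp [cyl]

/-- The sequence starting at `x` and continuing with `w`. -/
def consPath (x : V) (w : ℕ → V) : ℕ → V := fun n => Nat.casesOn n x w

@[simp] lemma consPath_zero (x : V) (w : ℕ → V) : consPath x w 0 = x := rfl
@[simp] lemma consPath_succ (x : V) (w : ℕ → V) (n : ℕ) : consPath x w (n + 1) = w n := rfl

/-- The sequence following `b` before time `n` and continuing with `w` from time `n` on. -/
def splice (n : ℕ) (b w : ℕ → V) : ℕ → V := fun i => if i < n then b i else w (i - n)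

lemma splice_zero (b w : ℕ → V) : splice 0 b w = w := by funext i; simp [splice]

lemma splice_succ (n : ℕ) (x : V) (b w : ℕ → V) :
    splice (n + 1) (consPath x b) w = consPath x (splice n b w) := by
  funext i
  cases i with
  | zero => simp [splice]
  | succ i => simp [splice]

lemma splice_add (n i : ℕ) (b w : ℕ → V) : splice n b w (n + i) = w i := by
  simp [splice]

variable [MeasurableSpace V]

/-- A finite measure on sequences in a countable discrete space is determined by cylinders. -/
lemma ext_of_cyl [Countable V] [DiscreteMeasurableSpace V] {μ ν : Measure (ℕ → V)}
    [IsFiniteMeasure μ] (h : ∀ v n, μ (cyl v n) = ν (cyl v n)) : μ = ν := by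
  have key : ∀ n, μ.map (Preorder.frestrictLe n) = ν.map (Preorder.frestrictLe n) := by
    intro n
    refine Measure.ext_of_singleton fun u => ?_
    have hu : ∃ v : ℕ → V, (Preorder.frestrictLe n v : (i : Finset.Iic n) → V) = u :=
      ⟨fun i => if hi : i ≤ n then u ⟨i, by simpa using hi⟩ else u ⟨0, by simp⟩, by
        funext i
        have := i.2
        simp only [Finset.mem_Iic] at this
        simp [this]⟩
    obtain ⟨v, rfl⟩ := hu
    have hpre : (Preorder.frestrictLe (π := fun _ => V) n) ⁻¹'
        {Preorder.frestrictLe (π := fun _ => V) n v} = cyl v n := by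
      ext w
      simp only [Set.mem_preimage, Set.mem_singleton_iff, cyl, Set.mem_ofPred_eq]
      constructor
      · intro hw i hi
        exact congrFun hw ⟨i, by simpa using hi⟩
      · intro hw
        funext i
        exact hw i (Finset.mem_Iic.1 i.2)
    rw [Measure.map_apply (Preorder.measurable_frestrictLe n) (measurableSet_singleton _),
      Measure.map_apply (Preorder.measurable_frestrictLe n) (measurableSet_singleton _), hpre, h]
  -- Every finite set of times lies in an initial segment, so agreement on initial segments gives
  -- agreement of all finite-dimensional marginals.
  have hlim : IsProjectiveLimit ν (fun I => μ.map I.restrict) := by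
    intro I
    have hsub : I ⊆ Finset.Iic (I.sup id) := fun i hi =>
      Finset.mem_Iic.2 (Finset.le_sup (f := id) hi)
    have hc : (I.restrict : (ℕ → V) → (I → V))
        = Finset.restrict₂ (π := fun _ => V) hsub ∘ Preorder.frestrictLe (I.sup id) := rfl
    have hmap : ∀ ρ : Measure (ℕ → V), ρ.map I.restrict
        = (ρ.map (Preorder.frestrictLe (I.sup id))).map
          (Finset.restrict₂ (π := fun _ => V) hsub) := fun ρ => by
      rw [hc, Measure.map_map (Finset.measurable_restrict₂ _) (Preorder.measurable_frestrictLe _)]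
    rw [hmap ν, ← key, ← hmap μ]
  have hlim' : IsProjectiveLimit μ (fun I => μ.map I.restrict) := fun I => rfl
  exact hlim'.unique hlim

@[fun_prop]
lemma measurable_consPath (x : V) : Measurable (consPath x) := by
  refine measurable_pi_iff.2 fun n => ?_
  cases n with
  | zero => exact measurable_const
  | succ n => exact measurable_pi_apply n

@[fun_prop]
lemma measurable_splice (n : ℕ) :
    Measurable (fun p : (ℕ → V) × (ℕ → V) => splice n p.1 p.2) := by
  refine measurable_pi_iff.2 fun i => ?_
  unfold splice
  by_cases h : i < n
  · simp only [h, if_true]; fun_prop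
  · simp only [h, if_false]; fun_prop

end Sequences

/-! ### The walk: cylinder probabilities and the Markov property -/

section Walk

variable {V : Type*} (G : SimpleGraph V) [G.LocallyFinite] (a : V → V → ℝ≥0)
  [MeasurableSpace V] [DiscreteMeasurableSpace V]

instance (x : V) : IsProbabilityMeasure (walkLaw G a x) := by
  unfold walkLaw; infer_instance

lemma measurableSet_eval (n : ℕ) (y : V) : MeasurableSet {w : ℕ → V | w n = y} :=
  measurable_pi_apply (X := fun _ : ℕ => V) n (measurableSet_singleton y)

lemma measurableSet_cyl (v : ℕ → V) (n : ℕ) : MeasurableSet (cyl v n) := by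
  have : cyl v n = ⋂ i ∈ Set.Iic n, (fun w : ℕ → V => w i) ⁻¹' {v i} := by
    ext w; simp [cyl]
  rw [this]
  exact MeasurableSet.biInter (Set.to_countable _)
    fun i _ => (measurable_pi_apply i) (measurableSet_singleton _)

lemma walkLaw_cyl_zero [DecidableEq V] (x : V) (v : ℕ → V) :
    walkLaw G a x (cyl v 0) = if v 0 = x then 1 else 0 := by
  have h := Kernel.traj_map_frestrictLe_apply (X := fun _ => V) (κ := fun n => (step G a).comap
    (fun h : (i : Finset.Iic n) → V => h ⟨n, Finset.mem_Iic.2 le_rfl⟩) (measurable_pi_apply _))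
    0 0 (fun _ => x)
  rw [Kernel.partialTraj_self, Kernel.id_apply] at h
  have h2 : cyl v 0 = (Preorder.frestrictLe 0) ⁻¹'
      ((fun u : (i : Finset.Iic 0) → V => u ⟨0, by simp⟩) ⁻¹' {v 0}) := by
    rw [cyl_zero]; rfl
  rw [h2, ← Measure.map_apply (Preorder.measurable_frestrictLe 0)
    ((measurable_pi_apply _) (measurableSet_singleton _)), walkLaw, h,
    Measure.dirac_apply' _ ((measurable_pi_apply _) (measurableSet_singleton _))]
  by_cases hv : v 0 = x
  · simp [hv]
  · simp [hv, Set.indicator, Ne.symm hv]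

lemma walkLaw_cyl_succ (x : V) (v : ℕ → V) (n : ℕ) :
    walkLaw G a x (cyl v (n + 1)) = walkLaw G a x (cyl v n) * step G a (v n) {v (n + 1)} := by
  have h := Kernel.partialTraj_compProd_eq_map_traj (X := fun _ => V)
    (κ := fun n => (step G a).comap
    (fun h : (i : Finset.Iic n) → V => h ⟨n, Finset.mem_Iic.2 le_rfl⟩) (measurable_pi_apply _))
    (Nat.zero_le n) (x₀ := fun _ => x)
  rw [← Kernel.traj_map_frestrictLe_apply] at h
  let A : Set ((i : Finset.Iic n) → V) := {u | ∀ i, u i = v i}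
  have hA : MeasurableSet A := by
    have : A = ⋂ i, (fun u : (i : Finset.Iic n) → V => u i) ⁻¹' {v i} := by ext u; simp [A]
    rw [this]
    exact MeasurableSet.iInter fun i => (measurable_pi_apply i) (measurableSet_singleton _)
  have h1 : cyl v n = (Preorder.frestrictLe n) ⁻¹' A := by
    ext w
    simp [cyl, A]
  have h2 : cyl v (n + 1) = (fun w : ℕ → V => (Preorder.frestrictLe (π := fun _ => V) n w,
      w (n + 1))) ⁻¹' (A ×ˢ {v (n + 1)}) := by
    ext w
    simp only [cyl, Set.mem_ofPred_eq, Set.mem_preimage, Set.mem_prod, A, Set.mem_singleton_iff]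
    constructor
    · intro hw
      exact ⟨fun i => hw i ((Finset.mem_Iic.1 i.2).trans n.le_succ), hw _ le_rfl⟩
    · rintro ⟨hw, hw'⟩ i hi
      rcases Nat.lt_or_ge n i with hi' | hi'
      · obtain rfl : i = n + 1 := by omega
        exact hw'
      · exact hw ⟨i, by simpa using hi'⟩
  have hm : MeasurableSet (A ×ˢ ({v (n + 1)} : Set V)) := hA.prod (measurableSet_singleton _)
  rw [h2, ← Measure.map_apply (by fun_prop) hm]
  unfold walkLaw
  rw [← h, Measure.compProd_apply_prod hA (measurableSet_singleton _), h1,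
    ← Measure.map_apply (Preorder.measurable_frestrictLe n) hA,
    setLIntegral_congr_fun (g := fun _ => step G a (v n) {v (n + 1)}) hA ?_,
    setLIntegral_const, mul_comm]
  intro u hu
  simp only [Kernel.comap_apply]
  rw [hu]

/-- The kernel `x ↦ P_x`. -/
def walkKernel : Kernel V (ℕ → V) where
  toFun := walkLaw G a
  measurable' := Measurable.of_discrete

@[simp] lemma walkKernel_apply (x : V) : walkKernel G a x = walkLaw G a x := rfl

instance : IsMarkovKernel (walkKernel G a) := ⟨fun x => by rw [walkKernel_apply]; infer_instance⟩

variable [Countable V]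

/-- The Markov property at time `1`. -/
lemma walkLaw_eq_bind (x : V) :
    walkLaw G a x = (step G a x).bind (fun y => (walkLaw G a y).map (consPath x)) := by
  classical
  refine ext_of_cyl fun v n => ?_
  have hm : Measurable (fun y => (walkLaw G a y).map (consPath x)) := Measurable.of_discrete
  rw [Measure.bind_apply (measurableSet_cyl v n) hm.aemeasurable]
  have hpre : ∀ n, consPath x ⁻¹' (cyl v (n + 1))
      = {w | v 0 = x ∧ w ∈ cyl (fun i => v (i + 1)) n} := by
    intro n
    ext w
    simp only [cyl, Set.mem_preimage, Set.mem_ofPred_eq]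
    constructor
    · intro h
      exact ⟨(h 0 (by omega)).symm, fun i hi => h (i + 1) (by omega)⟩
    · rintro ⟨h0, h⟩ i hi
      cases i with
      | zero => exact h0.symm
      | succ i => exact h i (by omega)
  have hstep : ∀ n, walkLaw G a x (cyl v (n + 1)) = (if v 0 = x then 1 else 0) *
      (step G a x {v 1} * walkLaw G a (v 1) (cyl (fun i => v (i + 1)) n)) := by
    intro n
    induction n with
    | zero =>
      rw [walkLaw_cyl_succ, walkLaw_cyl_zero, walkLaw_cyl_zero]
      by_cases h : v 0 = x
      · simp [h]
      · simp [h]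
    | succ n ih =>
      rw [walkLaw_cyl_succ, ih, walkLaw_cyl_succ G a (v 1)]
      simp only [mul_assoc]
  cases n with
  | zero =>
    rw [walkLaw_cyl_zero]
    have : ∀ y, (walkLaw G a y).map (consPath x) (cyl v 0) = if v 0 = x then 1 else 0 := by
      intro y
      rw [Measure.map_apply (measurable_consPath x) (measurableSet_cyl v 0), cyl_zero]
      by_cases h : v 0 = x
      · simp [h]
      · simp [h, Ne.symm h]
    simp [this]
  | succ n =>
    rw [hstep]
    by_cases h : v 0 = x
    · have : ∀ y, (walkLaw G a y).map (consPath x) (cyl v (n + 1))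
          = ({v 1} : Set V).indicator
            (fun _ => walkLaw G a (v 1) (cyl (fun i => v (i + 1)) n)) y := by
        intro y
        rw [Measure.map_apply (measurable_consPath x) (measurableSet_cyl v _), hpre]
        simp only [h, true_and, Set.ofPred_mem_eq]
        by_cases hy : y = v 1
        · simp [hy]
        · rw [Set.indicator_of_notMem (by simpa using hy)]
          refine measure_mono_null (t := cyl (fun i => v (i + 1)) 0) ?_ ?_
          · intro w hw i hi
            exact hw i (by omega)
          · rw [walkLaw_cyl_zero]; simp [Ne.symm hy]
      simp only [this]
      rw [lintegral_indicator_const (measurableSet_singleton _)]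
      simp [h, mul_comm]
    · have : ∀ y, (walkLaw G a y).map (consPath x) (cyl v (n + 1)) = 0 := by
        intro y
        rw [Measure.map_apply (measurable_consPath x) (measurableSet_cyl v _), hpre]
        simp [h]
      simp [this, h]

lemma ae_walkLaw_zero (x : V) : ∀ᵐ b ∂walkLaw G a x, b 0 = x := by
  classical
  have := walkLaw_cyl_zero G a x (fun _ => x)
  rw [cyl_zero, if_pos rfl] at this
  exact (prob_compl_eq_zero_iff (measurableSet_eval 0 x)).2 this

lemma lintegral_walkLaw (x : V) {f : (ℕ → V) → ℝ≥0∞} (hf : Measurable f) :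
    ∫⁻ w, f w ∂walkLaw G a x
      = ∫⁻ y, ∫⁻ w, f (consPath x w) ∂walkLaw G a y ∂step G a x := by
  conv_lhs => rw [walkLaw_eq_bind]
  rw [Measure.lintegral_bind Measurable.of_discrete.aemeasurable hf.aemeasurable]
  simp_rw [lintegral_map hf (measurable_consPath x)]

/-- The Markov property at time `n`. -/
lemma lintegral_walkLaw_splice (n : ℕ) (x : V) {f : (ℕ → V) → ℝ≥0∞} (hf : Measurable f) :
    ∫⁻ w, f w ∂walkLaw G a x
      = ∫⁻ b, ∫⁻ w, f (splice n b w) ∂walkLaw G a (b n) ∂walkLaw G a x := by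
  classical
  have hmeas : ∀ (n : ℕ) (f : (ℕ → V) → ℝ≥0∞), Measurable f →
      Measurable fun b : ℕ → V => ∫⁻ w, f (splice n b w) ∂walkLaw G a (b n) := by
    intro n f hf
    exact Measurable.lintegral_kernel_prod_right'
      (κ := (walkKernel G a).comap (fun b : ℕ → V => b n) (measurable_pi_apply n))
      (f := fun p => f (splice n p.1 p.2)) (hf.comp (measurable_splice n))
  induction n generalizing x f with
  | zero =>
    have : ∀ᵐ b ∂walkLaw G a x, ∫⁻ w, f (splice 0 b w) ∂walkLaw G a (b 0)
        = ∫⁻ w, f w ∂walkLaw G a x := by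
      filter_upwards [ae_walkLaw_zero G a x] with b hb
      simp [splice_zero, hb]
    rw [lintegral_congr_ae this]
    simp
  | succ n ih =>
    rw [lintegral_walkLaw G a x hf, lintegral_walkLaw G a x (hmeas (n + 1) f hf)]
    refine lintegral_congr fun y => ?_
    have := ih y (hf.comp (measurable_consPath x))
    simp only [Function.comp_apply] at this
    rw [this]
    simp only [splice_succ, consPath_succ]

end Walk

/-! ### Last visits, the Green function and reversibility -/

section Paths

variable {V : Type*}

/-- The sequence seen from time `n` on. -/
def shiftPath (n : ℕ) (w : ℕ → V) : ℕ → V := fun i => w (n + i)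

lemma shiftPath_splice (n : ℕ) (b w : ℕ → V) : shiftPath n (splice n b w) = w := by
  funext i; exact splice_add n i b w

/-- The paths that visit `y` for the last time at time `m`. -/
def lastVisit (y : V) (m : ℕ) : Set (ℕ → V) := {w | w m = y ∧ shiftPath m w ∈ noReturn {y}}

lemma mem_lastVisit {y : V} {m : ℕ} {w : ℕ → V} :
    w ∈ lastVisit y m ↔ w m = y ∧ ∀ n, m < n → w n ≠ y := by
  simp only [lastVisit, noReturn, shiftPath, Set.mem_ofPred_eq, Finset.mem_singleton]
  refine and_congr_right fun _ => ⟨fun h n hn => ?_, fun h n hn => h _ (by omega)⟩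
  have := h (n - m) (by omega)
  rwa [Nat.add_sub_cancel' hn.le] at this

lemma pairwise_disjoint_lastVisit (y : V) :
    Pairwise (Function.onFun Disjoint (lastVisit y)) := by
  intro m n hmn
  refine Set.disjoint_left.2 fun w hw hw' => ?_
  rw [mem_lastVisit] at hw hw'
  rcases lt_or_gt_of_ne hmn with h | h
  · exact hw.2 n h hw'.1
  · exact hw'.2 m h hw.1

lemma exists_mem_lastVisit {y : V} {w : ℕ → V} (h0 : ∃ n, w n = y)
    (hf : {n | w n = y}.Finite) : ∃ m, w ∈ lastVisit y m := by
  obtain ⟨m, hm, hmax⟩ := Set.exists_max_image _ id hf h0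
  exact ⟨m, mem_lastVisit.2 ⟨hm, fun n hn h => absurd (hmax n h) (by simpa using hn)⟩⟩

end Paths

section Green

variable {V : Type*} (G : SimpleGraph V) [G.LocallyFinite] (a : V → V → ℝ≥0)
  [MeasurableSpace V] [DiscreteMeasurableSpace V]

@[fun_prop]
lemma measurable_shiftPath (n : ℕ) : Measurable (shiftPath (V := V) n) := by
  unfold shiftPath; fun_prop

/-- The `n`-step transition probabilities. -/
def transProb (n : ℕ) (x y : V) : ℝ≥0∞ := walkLaw G a x {w | w n = y}

/-- The Green function, with values in `[0, ∞]`. -/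
def green (x y : V) : ℝ≥0∞ := ∑' n, transProb G a n x y

section
variable [Countable V]

/-- The Markov property at a fixed time, in the form for events: restarting at time `n` from `y`
makes the future independent of how `y` was reached. -/
lemma walkLaw_inter_shift (n : ℕ) (x y : V) {A : Set (ℕ → V)} (hA : MeasurableSet A) :
    walkLaw G a x {w | w n = y ∧ shiftPath n w ∈ A}
      = transProb G a n x y * walkLaw G a y A := by
  classical
  have hm : MeasurableSet {w : ℕ → V | w n = y ∧ shiftPath n w ∈ A} :=
    (measurableSet_eval n y).inter (measurable_shiftPath n hA)
  rw [← lintegral_indicator_one hm,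
    lintegral_walkLaw_splice G a n x (measurable_one.indicator hm)]
  have h : ∀ b : ℕ → V, ∫⁻ w, {w | w n = y ∧ shiftPath n w ∈ A}.indicator 1 (splice n b w)
      ∂walkLaw G a (b n) = {w : ℕ → V | w n = y}.indicator (fun _ => walkLaw G a y A) b := by
    intro b
    have h1 : ∀ᵐ w ∂walkLaw G a (b n),
        {w | w n = y ∧ shiftPath n w ∈ A}.indicator (1 : (ℕ → V) → ℝ≥0∞) (splice n b w)
          = if b n = y then A.indicator 1 w else 0 := by
      filter_upwards [ae_walkLaw_zero G a (b n)] with w hw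
      have h0 : splice n b w n = b n := by
        have := splice_add n 0 b w
        rwa [add_zero, hw] at this
      by_cases hb : b n = y
      · by_cases hA' : w ∈ A
        · rw [Set.indicator_of_mem, if_pos hb, Set.indicator_of_mem hA']
          · rfl
          · exact ⟨h0.trans hb, by rwa [shiftPath_splice]⟩
        · rw [Set.indicator_of_notMem, if_pos hb, Set.indicator_of_notMem hA']
          rintro ⟨-, h⟩
          rw [shiftPath_splice] at h
          exact hA' h
      · rw [Set.indicator_of_notMem, if_neg hb]
        rintro ⟨h, -⟩
        exact hb (h0.symm.trans h)
    rw [lintegral_congr_ae h1]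
    by_cases hb : b n = y
    · rw [Set.indicator_of_mem (by exact hb)]
      simp only [hb, if_true]
      exact lintegral_indicator_one hA
    · rw [Set.indicator_of_notMem (by exact hb)]
      simp [hb]
  simp_rw [h]
  rw [lintegral_indicator_const (measurableSet_eval n y), mul_comm, transProb]

lemma chapman_kolmogorov (n m : ℕ) (x y : V) :
    transProb G a (n + m) x y = ∑' z, transProb G a n x z * transProb G a m z y := by
  have hU : {w : ℕ → V | w (n + m) = y}
      = ⋃ z, {w | w n = z ∧ shiftPath n w ∈ {w : ℕ → V | w m = y}} := by
    ext w; simp [shiftPath]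
  rw [transProb, hU, measure_iUnion]
  · exact tsum_congr fun z => walkLaw_inter_shift G a n x z (measurableSet_eval m y)
  · intro z z' hzz'
    exact Set.disjoint_left.2 fun w hw hw' => hzz' (hw.1.symm.trans hw'.1)
  · exact fun z => (measurableSet_eval n z).inter
      (measurable_shiftPath n (measurableSet_eval m y))

lemma mul_transProb_le (n m : ℕ) (x z y : V) :
    transProb G a n x z * transProb G a m z y ≤ transProb G a (n + m) x y := by
  rw [chapman_kolmogorov]
  exact ENNReal.le_tsum z

lemma measurableSet_noReturn (K : Finset V) : MeasurableSet (noReturn K) := by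
  have : noReturn K = ⋂ n ∈ Set.Ici 1, (fun w : ℕ → V => w n) ⁻¹' (K : Set V)ᶜ := by
    ext w; simp [noReturn]
  rw [this]
  exact MeasurableSet.biInter (Set.to_countable _)
    fun n _ => (measurable_pi_apply n) MeasurableSet.of_discrete

lemma measurableSet_lastVisit (y : V) (m : ℕ) : MeasurableSet (lastVisit y m) :=
  (measurableSet_eval m y).inter (measurable_shiftPath m (measurableSet_noReturn {y}))

/-- Last-exit decomposition: if `y` is visited finitely often, exactly one `m` is the time of the
last visit, and the Markov property at `m` gives the product of the Green function and the escape
probability the value `1`. -/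
lemma green_self_ne_top (y : V) (h : ∀ᵐ w ∂walkLaw G a y, {n : ℕ | w n = y}.Finite) :
    green G a y y ≠ ∞ ∧ walkLaw G a y (noReturn {y}) ≠ 0 := by
  have h1 : walkLaw G a y (⋃ m, lastVisit y m) = 1 := by
    have : ∀ᵐ w ∂walkLaw G a y, w ∈ ⋃ m, lastVisit y m := by
      filter_upwards [h, ae_walkLaw_zero G a y] with w hw h0
      exact Set.mem_iUnion.2 (exists_mem_lastVisit ⟨0, h0⟩ hw)
    exact (prob_compl_eq_zero_iff (MeasurableSet.iUnion (measurableSet_lastVisit y))).1 this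
  rw [measure_iUnion (pairwise_disjoint_lastVisit y) (measurableSet_lastVisit y)] at h1
  have h2 : green G a y y * walkLaw G a y (noReturn {y}) = 1 := by
    rw [green, ← ENNReal.tsum_mul_right, ← h1]
    exact tsum_congr fun m => (walkLaw_inter_shift G a m y y (measurableSet_noReturn {y})).symm
  constructor
  · intro ht
    rw [ht] at h2
    by_cases hq : walkLaw G a y (noReturn {y}) = 0
    · rw [hq] at h2; simp at h2
    · rw [ENNReal.top_mul hq] at h2; simp at h2
  · intro hq
    rw [hq] at h2; simp at h2

end

variable {G a}

lemma totalWeight_ne_zero_of_adj (ha_pos : ∀ x y, G.Adj x y → 0 < a x y) {x y : V}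
    (h : G.Adj x y) : totalWeight G a x ≠ 0 := by
  have : 0 < totalWeight G a x :=
    Finset.sum_pos (fun z hz => ha_pos x z (by simpa using hz)) ⟨y, by simpa using h⟩
  exact this.ne'

variable [Countable V]

/-- The only possible exception is a one-vertex graph, on which every path stays put and transience
fails. -/
lemma IsTransient.totalWeight_ne_zero (htrans : IsTransient G a) (hG : G.Connected)
    (ha_pos : ∀ x y, G.Adj x y → 0 < a x y) (x : V) : totalWeight G a x ≠ 0 := by
  rcases subsingleton_or_nontrivial V with hV | hV
  · obtain ⟨w, hw⟩ := (htrans x).exists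
    have : {n : ℕ | w n = x} = Set.univ := by
      ext n; simp [Subsingleton.elim (w n) x]
    rw [this] at hw
    exact absurd hw Set.infinite_univ
  · obtain ⟨y, hy⟩ := hG.preconnected.exists_adj_of_nontrivial x
    exact totalWeight_ne_zero_of_adj ha_pos hy

lemma step_singleton [DecidableRel G.Adj] (x y : V) (hx : totalWeight G a x ≠ 0) :
    step G a x {y} = if G.Adj x y then (a x y : ℝ≥0∞) / totalWeight G a x else 0 := by
  classical
  simp only [step, Kernel.coe_mk, hx, if_false, Measure.coe_finsetSum, Finset.sum_apply,
    Measure.smul_apply, smul_eq_mul]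
  by_cases h : G.Adj x y
  · rw [if_pos h, Finset.sum_eq_single y]
    · simp
    · intro z _ hz
      simp [hz]
    · intro hy
      simp [h] at hy
  · rw [if_neg h]
    refine Finset.sum_eq_zero fun z hz => ?_
    have : z ≠ y := by
      rintro rfl
      simp at hz
      exact h hz
    simp [this]

lemma totalWeight_mul_step (ha_symm : ∀ x y, a x y = a y x)
    (ha : ∀ x, totalWeight G a x ≠ 0) (x y : V) :
    (totalWeight G a x : ℝ≥0∞) * step G a x {y} = totalWeight G a y * step G a y {x} := by
  classical
  have h' : ∀ x, (totalWeight G a x : ℝ≥0∞) ≠ 0 := fun x => by exact_mod_cast ha x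
  rw [step_singleton x y (ha x), step_singleton y x (ha y), G.adj_comm y x]
  by_cases h : G.Adj x y
  · rw [if_pos h, if_pos h, ENNReal.mul_div_cancel (h' x) ENNReal.coe_ne_top,
      ENNReal.mul_div_cancel (h' y) ENNReal.coe_ne_top, ha_symm]
  · simp [h]

lemma transProb_one (x y : V) : transProb G a 1 x y = step G a x {y} := by
  rw [transProb, ← lintegral_indicator_one (measurableSet_eval 1 y),
    lintegral_walkLaw G a x (measurable_one.indicator (measurableSet_eval 1 y)),
    ← lintegral_indicator_one (measurableSet_singleton y)]
  refine lintegral_congr fun z => ?_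
  have : ∀ᵐ w ∂walkLaw G a z, {w : ℕ → V | w 1 = y}.indicator (1 : (ℕ → V) → ℝ≥0∞)
      (consPath x w) = ({y} : Set V).indicator 1 z := by
    filter_upwards [ae_walkLaw_zero G a z] with w hw
    by_cases h : z = y
    · rw [Set.indicator_of_mem, Set.indicator_of_mem]
      · rfl
      · exact h
      · exact hw.trans h
    · rw [Set.indicator_of_notMem, Set.indicator_of_notMem]
      · exact h
      · exact fun h' => h (hw.symm.trans h')
  rw [lintegral_congr_ae this]
  simp

lemma exists_transProb_ne_zero (hG : G.Connected) (ha_pos : ∀ x y, G.Adj x y → 0 < a x y)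
    (x y : V) : ∃ n, transProb G a n x y ≠ 0 := by
  classical
  obtain ⟨p⟩ := hG.preconnected x y
  induction p with
  | nil =>
    refine ⟨0, ?_⟩
    rename_i u
    have : transProb G a 0 u u = 1 :=
      (prob_compl_eq_zero_iff (measurableSet_eval 0 u)).1 (ae_walkLaw_zero G a u)
    simp [this]
  | cons h p ih =>
    rename_i u v w
    obtain ⟨n, hn⟩ := ih
    refine ⟨1 + n, ne_of_gt (lt_of_lt_of_le ?_ (mul_transProb_le G a 1 n u v w))⟩
    rw [transProb_one, step_singleton u v (totalWeight_ne_zero_of_adj ha_pos h), if_pos h]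
    refine ENNReal.mul_pos ?_ hn
    refine (ENNReal.div_pos ?_ ENNReal.coe_ne_top).ne'
    exact_mod_cast (ha_pos u v h).ne'

/-- By connectedness `y` leads to `x` with positive probability in some number `k` of steps;
prefixing these steps bounds a positive multiple of the off-diagonal series by the diagonal one. -/
lemma IsTransient.green_ne_top (htrans : IsTransient G a) (hG : G.Connected)
    (ha_pos : ∀ x y, G.Adj x y → 0 < a x y) (x y : V) : green G a x y ≠ ∞ := by
  obtain ⟨k, hk⟩ := exists_transProb_ne_zero hG ha_pos y x
  have h1 : transProb G a k y x * green G a x y ≤ green G a y y := by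
    rw [green, ← ENNReal.tsum_mul_left]
    calc ∑' n, transProb G a k y x * transProb G a n x y
        ≤ ∑' n, transProb G a (k + n) y y :=
          ENNReal.tsum_le_tsum fun n => mul_transProb_le G a k n y x y
      _ ≤ green G a y y := ENNReal.tsum_comp_le_tsum_of_injective (add_right_injective k) _
  intro ht
  rw [ht, ENNReal.mul_top hk] at h1
  exact (green_self_ne_top G a y (htrans y)).1 (top_le_iff.1 h1)

/-- The one-sided nearest-neighbour paths that visit every vertex finitely often. -/
def goodPaths (G : SimpleGraph V) : Set (ℕ → V) :=
  {w | (∀ n, G.Adj (w n) (w (n + 1))) ∧ ∀ x, {n | w n = x}.Finite}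

/-- Non-edges are crossed with probability zero, and finiteness of the visits to every vertex is
Borel–Cantelli applied to the finite Green function. -/
lemma IsTransient.ae_mem_goodPaths (htrans : IsTransient G a) (hG : G.Connected)
    (ha_pos : ∀ x y, G.Adj x y → 0 < a x y) (x : V) :
    ∀ᵐ w ∂walkLaw G a x, w ∈ goodPaths G := by
  classical
  have h1 : ∀ n, ∀ᵐ w ∂walkLaw G a x, G.Adj (w n) (w (n + 1)) := by
    intro n
    have : {w : ℕ → V | ¬ G.Adj (w n) (w (n + 1))} ⊆
        ⋃ p : {p : V × V // ¬ G.Adj p.1 p.2},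
          {w | w n = p.1.1 ∧ shiftPath n w ∈ {w : ℕ → V | w 1 = p.1.2}} := by
      intro w hw
      exact Set.mem_iUnion.2 ⟨⟨(w n, w (n + 1)), hw⟩, rfl, rfl⟩
    refine measure_mono_null this (measure_iUnion_null fun p => ?_)
    rw [walkLaw_inter_shift G a n x p.1.1 (measurableSet_eval 1 p.1.2)]
    have : transProb G a 1 p.1.1 p.1.2 = 0 := by
      rw [transProb_one, step_singleton _ _ (htrans.totalWeight_ne_zero hG ha_pos _), if_neg p.2]
    rw [transProb] at this
    rw [this, mul_zero]
  have h2 : ∀ y, ∀ᵐ w ∂walkLaw G a x, {n : ℕ | w n = y}.Finite := fun y =>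
    ae_finite_setOfPred_mem (s := fun n => {w : ℕ → V | w n = y})
      (htrans.green_ne_top hG ha_pos x y)
  filter_upwards [ae_all_iff.2 h1, ae_all_iff.2 h2] with w hw1 hw2
  exact ⟨hw1, hw2⟩

end Green

/-! ### The stationary two-sided walk and its shift invariance -/

section TwoSided

variable {V : Type*}

/-- The time shift by `k` on two-sided sequences. -/
def shiftZ (k : ℤ) (w : ℤ → V) : ℤ → V := fun n => w (n + k)

lemma glue_nonpos (p : (ℕ → V) × (ℕ → V)) (j : ℕ) : glue p (-(j : ℤ)) = p.1 j := by
  simp [glue]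

lemma glue_pos (p : (ℕ → V) × (ℕ → V)) {j : ℕ} (hj : 1 ≤ j) : glue p (j : ℤ) = p.2 j := by
  have : ¬ ((j : ℤ) ≤ 0) := by omega
  simp only [glue, this, if_false, Int.toNat_natCast]

lemma glue_nonneg (p : (ℕ → V) × (ℕ → V)) (h : p.1 0 = p.2 0) (j : ℕ) :
    glue p (j : ℤ) = p.2 j := by
  rcases Nat.eq_zero_or_pos j with rfl | hj
  · simpa [glue] using h
  · exact glue_pos p hj

/-- A unit shift moves the origin from the past to the end of the first future step. The condition
on `β 0` is needed because `glue` reads time `0` from its first component only. -/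
lemma shiftZ_glue_consPath {x y : V} {α β : ℕ → V} (hβ : β 0 = y) :
    shiftZ 1 (glue (α, consPath x β)) = glue (consPath y α, β) := by
  funext n
  obtain ⟨j, rfl | rfl⟩ := n.eq_nat_or_neg
  · rcases Nat.eq_zero_or_pos j with rfl | hj
    · have : glue (α, consPath x β) ((1 : ℕ) : ℤ) = β 0 := glue_pos _ le_rfl
      simpa [shiftZ, glue] using hβ
    · rw [glue_pos _ hj]
      have : (j : ℤ) + 1 = ((j + 1 : ℕ) : ℤ) := by push_cast; ring
      rw [shiftZ, this, glue_pos _ (by omega)]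
      rfl
  · rw [glue_nonpos]
    rcases Nat.eq_zero_or_pos j with rfl | hj
    · have : glue (α, consPath x β) ((1 : ℕ) : ℤ) = β 0 := glue_pos _ le_rfl
      simpa [shiftZ] using this.trans hβ
    · obtain ⟨i, rfl⟩ : ∃ i, j = i + 1 := ⟨j - 1, by omega⟩
      have : -((i + 1 : ℕ) : ℤ) + 1 = -(i : ℤ) := by push_cast; ring
      rw [shiftZ, this, glue_nonpos]
      rfl

variable [MeasurableSpace V]

@[fun_prop]
lemma measurable_glue : Measurable (glue (V := V)) := by
  refine measurable_pi_iff.2 fun n => ?_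
  unfold glue
  by_cases h : n ≤ 0
  · simp only [h, if_true]; fun_prop
  · simp only [h, if_false]; fun_prop

@[fun_prop]
lemma measurable_shiftZ (k : ℤ) : Measurable (shiftZ (V := V) k) := by
  unfold shiftZ; fun_prop

variable (G : SimpleGraph V) [G.LocallyFinite] (a : V → V → ℝ≥0) [DiscreteMeasurableSpace V]

/-- The product `P_x ⊗ P_x`, the law of the two halves of a two-sided walk through `x`. -/
def pairLaw (x : V) : Measure ((ℕ → V) × (ℕ → V)) := (walkLaw G a x).prod (walkLaw G a x)

instance (x : V) : IsProbabilityMeasure (pairLaw G a x) := by unfold pairLaw; infer_instance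

/-- The stationary two-sided walk: the (infinite) measure on two-sided sequences with
one-dimensional marginals `x ↦ a_x`. -/
def twoSided : Measure (ℤ → V) :=
  Measure.sum fun x : V => (totalWeight G a x : ℝ≥0∞) • (pairLaw G a x).map glue

lemma lintegral_twoSided {f : (ℤ → V) → ℝ≥0∞} (hf : Measurable f) :
    ∫⁻ w, f w ∂twoSided G a
      = ∑' x, (totalWeight G a x : ℝ≥0∞) * ∫⁻ p, f (glue p) ∂pairLaw G a x := by
  rw [twoSided, lintegral_sum_measure]
  simp_rw [lintegral_smul_measure, lintegral_map hf measurable_glue, smul_eq_mul]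

lemma ae_pairLaw {Q : (ℕ → V) → Prop} {x : V} (h : ∀ᵐ w ∂walkLaw G a x, Q w) :
    ∀ᵐ p ∂pairLaw G a x, Q p.1 ∧ Q p.2 := by
  have h1 := Measure.quasiMeasurePreserving_fst (μ := walkLaw G a x) (ν := walkLaw G a x)
  have h2 := Measure.quasiMeasurePreserving_snd (μ := walkLaw G a x) (ν := walkLaw G a x)
  exact (h1.ae h).and (h2.ae h)

variable {G a} [Countable V]

/-- Expand the first step of the future before the shift, and the first step of the past after it.
Both sides become sums over edges of the same integrals, with weights that agree by detailed
balance. -/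
lemma lintegral_twoSided_shiftZ_one (ha_symm : ∀ x y, a x y = a y x)
    (ha : ∀ x, totalWeight G a x ≠ 0) {f : (ℤ → V) → ℝ≥0∞} (hf : Measurable f) :
    ∫⁻ w, f (shiftZ 1 w) ∂twoSided G a = ∫⁻ w, f w ∂twoSided G a := by
  rw [lintegral_twoSided G a (f := fun w => f (shiftZ 1 w)) (hf.comp (measurable_shiftZ 1)),
    lintegral_twoSided G a hf]
  have hg : ∀ y, Measurable fun p : (ℕ → V) × (ℕ → V) => f (glue (consPath y p.1, p.2)) :=
    fun y => hf.comp (measurable_glue.comp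
      (((measurable_consPath y).comp measurable_fst).prodMk measurable_snd))
  have hL : ∀ x, ∫⁻ p, f (shiftZ 1 (glue p)) ∂pairLaw G a x
      = ∑' y, step G a x {y} * ∫⁻ α, ∫⁻ β, f (glue (consPath y α, β)) ∂walkLaw G a y
        ∂walkLaw G a x := by
    intro x
    have h0 : ∀ α : ℕ → V, Measurable fun β => f (shiftZ 1 (glue (α, β))) := fun α =>
      hf.comp ((measurable_shiftZ 1).comp (measurable_glue.comp measurable_prodMk_left))
    rw [pairLaw, lintegral_prod (fun p => f (shiftZ 1 (glue p)))
      (hf.comp ((measurable_shiftZ 1).comp measurable_glue)).aemeasurable]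
    have h1 : ∀ α : ℕ → V, ∫⁻ β, f (shiftZ 1 (glue (α, β))) ∂walkLaw G a x
        = ∑' y, step G a x {y} * ∫⁻ β, f (glue (consPath y α, β)) ∂walkLaw G a y := by
      intro α
      rw [lintegral_walkLaw G a x (h0 α), lintegral_countable']
      refine tsum_congr fun y => ?_
      rw [mul_comm]
      congr 1
      refine lintegral_congr_ae ?_
      filter_upwards [ae_walkLaw_zero G a y] with β hβ
      rw [shiftZ_glue_consPath hβ]
    simp_rw [h1]
    rw [lintegral_tsum fun y => ((hg y).lintegral_prod_right'.const_mul _).aemeasurable]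
    exact tsum_congr fun y => lintegral_const_mul _ (hg y).lintegral_prod_right'
  have hR : ∀ y, ∫⁻ p, f (glue p) ∂pairLaw G a y
      = ∑' x, step G a y {x} * ∫⁻ α, ∫⁻ β, f (glue (consPath y α, β)) ∂walkLaw G a y
        ∂walkLaw G a x := by
    intro y
    rw [pairLaw, lintegral_prod (fun p => f (glue p)) (hf.comp measurable_glue).aemeasurable,
      lintegral_walkLaw G a y (f := fun α => ∫⁻ β, f (glue (α, β)) ∂walkLaw G a y)
      (hf.comp measurable_glue).lintegral_prod_right',
      lintegral_countable']
    exact tsum_congr fun x => mul_comm _ _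
  simp_rw [hL, hR, ← ENNReal.tsum_mul_left, ← mul_assoc]
  rw [ENNReal.tsum_comm]
  refine tsum_congr fun y => tsum_congr fun x => ?_
  rw [totalWeight_mul_step ha_symm ha x y]

lemma lintegral_twoSided_shiftZ (ha_symm : ∀ x y, a x y = a y x)
    (ha : ∀ x, totalWeight G a x ≠ 0) (m : ℕ) {f : (ℤ → V) → ℝ≥0∞} (hf : Measurable f) :
    ∫⁻ w, f (shiftZ m w) ∂twoSided G a = ∫⁻ w, f w ∂twoSided G a := by
  induction m generalizing f with
  | zero =>
    have : ∀ w : ℤ → V, shiftZ ((0 : ℕ) : ℤ) w = w := fun w => by funext n; simp [shiftZ]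
    simp_rw [this]
  | succ m ih =>
    rw [← ih hf, ← lintegral_twoSided_shiftZ_one ha_symm ha
      (f := fun w => f (shiftZ m w)) (hf.comp (measurable_shiftZ m))]
    refine lintegral_congr fun w => ?_
    congr 1
    funext n
    simp only [shiftZ]
    congr 1
    push_cast
    ring

lemma twoSided_apply_of_subset {A : Set (ℤ → V)} (hA : MeasurableSet A) {u : V}
    (h : ∀ w ∈ A, w 0 = u) :
    twoSided G a A = totalWeight G a u * pairLaw G a u (glue ⁻¹' A) := by
  rw [twoSided, Measure.sum_apply _ hA, tsum_eq_single u]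
  · rw [Measure.smul_apply, Measure.map_apply measurable_glue hA, smul_eq_mul]
  · intro x hx
    rw [Measure.smul_apply, Measure.map_apply measurable_glue hA, smul_eq_mul]
    have : pairLaw G a x (glue ⁻¹' A) = 0 := by
      have h0 := ae_pairLaw G a (ae_walkLaw_zero G a x)
      refine measure_mono_null (fun p hp => ?_) h0
      intro hp'
      have := h _ hp
      have h2 := glue_nonpos p 0
      simp only [Nat.cast_zero, neg_zero] at h2
      exact hx (hp'.1.symm.trans (h2.symm.trans this))
    rw [this, mul_zero]

lemma totalWeight_mul_transProb (ha_symm : ∀ x y, a x y = a y x)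
    (ha : ∀ x, totalWeight G a x ≠ 0) (n : ℕ) (x y : V) :
    (totalWeight G a x : ℝ≥0∞) * transProb G a n x y
      = totalWeight G a y * transProb G a n y x := by
  induction n generalizing x y with
  | zero =>
    by_cases h : x = y
    · rw [h]
    · have h0 : ∀ x y : V, x ≠ y → transProb G a 0 x y = 0 := fun x y h =>
        measure_mono_null (fun w (hw : w 0 = y) (hw' : w 0 = x) => h (hw'.symm.trans hw))
          (ae_walkLaw_zero G a x)
      rw [h0 x y h, h0 y x (Ne.symm h), mul_zero, mul_zero]
  | succ n ih =>
    rw [add_comm n 1, chapman_kolmogorov, add_comm 1 n, chapman_kolmogorov,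
      ← ENNReal.tsum_mul_left, ← ENNReal.tsum_mul_left]
    refine tsum_congr fun z => ?_
    rw [← mul_assoc, transProb_one, totalWeight_mul_step ha_symm ha x z, mul_right_comm, ih z y,
      transProb_one, mul_assoc]

end TwoSided

/-! ### Trajectories modulo shift and their visit counts -/

section Classes

variable {V : Type*} (G : SimpleGraph V)

/-- The set of transient nearest-neighbour trajectories. -/
def trajSet : Set (ℤ → V) :=
  {w | (∀ n, G.Adj (w n) (w (n + 1))) ∧ ∀ x, {n : ℤ | w n = x}.Finite}

variable {G}

lemma glue_mem_trajSet {p : (ℕ → V) × (ℕ → V)} (h : p.1 0 = p.2 0) (h1 : p.1 ∈ goodPaths G)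
    (h2 : p.2 ∈ goodPaths G) : glue p ∈ trajSet G := by
  constructor
  · intro n
    obtain ⟨j, rfl | rfl⟩ := n.eq_nat_or_neg
    · have : (j : ℤ) + 1 = ((j + 1 : ℕ) : ℤ) := by push_cast; ring
      rw [this, glue_nonneg p h, glue_nonneg p h]
      exact h2.1 j
    · rcases Nat.eq_zero_or_pos j with rfl | hj
      · have e0 := glue_nonneg p h 0
        have e1 := glue_nonneg p h 1
        simp only [Nat.cast_zero, Nat.cast_one] at e0 e1
        simp only [Nat.cast_zero, neg_zero, zero_add, e0, e1]
        exact h2.1 0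
      · obtain ⟨i, rfl⟩ : ∃ i, j = i + 1 := ⟨j - 1, by omega⟩
        have : -((i + 1 : ℕ) : ℤ) + 1 = -(i : ℤ) := by push_cast; ring
        rw [this, glue_nonpos, glue_nonpos]
        exact (h1.1 i).symm
  · intro x
    refine (((h1.2 x).image (fun j : ℕ => -(j : ℤ))).union
      ((h2.2 x).image (fun j : ℕ => (j : ℤ)))).subset ?_
    intro n hn
    obtain ⟨j, rfl | rfl⟩ := n.eq_nat_or_neg
    · exact Or.inr ⟨j, (glue_nonneg p h j).symm.trans hn, rfl⟩
    · exact Or.inl ⟨j, (glue_nonpos p j).symm.trans hn, rfl⟩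

lemma shiftZ_mem_trajSet {w : ℤ → V} (k : ℤ) (hw : w ∈ trajSet G) : shiftZ k w ∈ trajSet G := by
  constructor
  · intro n
    have := hw.1 (n + k)
    simpa [shiftZ, add_right_comm] using this
  · intro x
    exact (hw.2 x).preimage (f := fun n : ℤ => n + k) (add_left_injective k).injOn

lemma shiftZ_mem_trajSet_iff {w : ℤ → V} (k : ℤ) : shiftZ k w ∈ trajSet G ↔ w ∈ trajSet G := by
  refine ⟨fun h => ?_, shiftZ_mem_trajSet k⟩
  have := shiftZ_mem_trajSet (-k) h
  convert this using 1
  funext n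
  simp [shiftZ]

open Classical in
/-- The class modulo time shift of a two-sided sequence; the junk value `w₀` is used outside the
set of transient nearest-neighbour trajectories. -/
def mk (w₀ : TrajMod G) (w : ℤ → V) : TrajMod G :=
  if h : w ∈ trajSet G then proj ⟨w, h⟩ else w₀

lemma mk_of_mem (w₀ : TrajMod G) {w : ℤ → V} (h : w ∈ trajSet G) :
    mk w₀ w = proj ⟨w, h⟩ := by simp [mk, h]

lemma mk_val (w₀ : TrajMod G) (w : Traj G) : mk w₀ w.1 = proj w := mk_of_mem w₀ w.2

lemma mk_shiftZ (w₀ : TrajMod G) (k : ℤ) (w : ℤ → V) : mk w₀ (shiftZ k w) = mk w₀ w := by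
  by_cases h : w ∈ trajSet G
  · rw [mk_of_mem w₀ h, mk_of_mem w₀ (shiftZ_mem_trajSet k h)]
    exact Quotient.sound (s := shiftSetoid G) ⟨-k, fun n => by simp [shiftZ]⟩
  · have h' : shiftZ k w ∉ trajSet G := by rwa [shiftZ_mem_trajSet_iff]
    simp [mk, h, h']

variable [MeasurableSpace V] [DiscreteMeasurableSpace V]

lemma measurableSet_evalZ (n : ℤ) (y : V) : MeasurableSet {w : ℤ → V | w n = y} :=
  measurable_pi_apply (X := fun _ : ℤ => V) n (measurableSet_singleton y)

variable [Countable V]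

variable (G) in
lemma measurableSet_trajSet : MeasurableSet (trajSet G) := by
  have h1 : MeasurableSet {w : ℤ → V | ∀ n, G.Adj (w n) (w (n + 1))} := by
    have : {w : ℤ → V | ∀ n, G.Adj (w n) (w (n + 1))}
        = ⋂ n, (fun w : ℤ → V => (w n, w (n + 1))) ⁻¹' {q | G.Adj q.1 q.2} := by
      ext w; simp
    rw [this]
    exact MeasurableSet.iInter fun n =>
      (by fun_prop : Measurable fun w : ℤ → V => (w n, w (n + 1))) MeasurableSet.of_discrete
  have h2 : MeasurableSet {w : ℤ → V | ∀ x, {n : ℤ | w n = x}.Finite} := by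
    have : {w : ℤ → V | ∀ x, {n : ℤ | w n = x}.Finite}
        = ⋂ x, ⋃ s : Finset ℤ, ⋂ n : {n // n ∉ s}, {w : ℤ → V | w n = x}ᶜ := by
      ext w
      simp only [Set.mem_ofPred_eq, Set.mem_iInter, Set.mem_iUnion, Set.mem_compl_iff]
      refine forall_congr' fun x => ⟨fun h => ⟨h.toFinset, fun n hn => ?_⟩, ?_⟩
      · exact n.2 (by simpa using hn)
      · rintro ⟨s, hs⟩
        refine s.finite_toSet.subset fun n hn => ?_
        by_contra hns
        exact hs ⟨n, by simpa using hns⟩ hn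
    rw [this]
    exact MeasurableSet.iInter fun x => MeasurableSet.iUnion fun s =>
      MeasurableSet.iInter fun n => (measurableSet_evalZ n x).compl
  exact h1.inter h2

lemma measurable_proj : Measurable (proj (G := G)) := measurable_quotient_mk''

lemma measurable_mk (w₀ : TrajMod G) : Measurable (mk w₀) := by
  classical
  have h1 : Measurable fun w : trajSet G => proj (G := G) ⟨w.1, w.2⟩ :=
    measurable_proj.comp (measurable_subtype_coe.subtype_mk)
  have h2 : Measurable fun _ : ((trajSet G)ᶜ : Set (ℤ → V)) => w₀ := measurable_const
  unfold mk
  exact Measurable.dite h1 h2 (measurableSet_trajSet G)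

/-- This moves all computations with the intensity to the product space of sequences, where
pushforwards under `glue` are available. -/
lemma map_proj_comap_val (w₀ : TrajMod G) (μ : Measure (ℤ → V)) :
    (μ.comap (Subtype.val : Traj G → ℤ → V)).map proj = (μ.restrict (trajSet G)).map (mk w₀) := by
  ext D hD
  have he : MeasurableEmbedding (Subtype.val : Traj G → ℤ → V) :=
    MeasurableEmbedding.subtype_coe (measurableSet_trajSet G)
  rw [Measure.map_apply measurable_proj hD, he.comap_apply, Measure.map_apply (measurable_mk w₀) hD,
    Measure.restrict_apply (measurable_mk w₀ hD)]
  congr 1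
  ext w
  constructor
  · rintro ⟨w', hw', rfl⟩
    exact ⟨by rw [Set.mem_preimage, mk_val]; exact hw', w'.2⟩
  · rintro ⟨hw, hw'⟩
    rw [Set.mem_preimage, mk_of_mem w₀ hw'] at hw
    exact ⟨⟨w, hw'⟩, hw, rfl⟩

/-- The number of visits to `u`. -/
def visits (u : V) : TrajMod G → ℝ≥0∞ :=
  Quotient.lift (fun w : Traj G => ∑' n : ℤ, {w : ℤ → V | w n = u}.indicator 1 w.1) (by
    classical
    rintro w w' ⟨k, hk⟩
    rw [← (Equiv.addRight k).tsum_eq]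
    refine tsum_congr fun n => ?_
    simp only [Equiv.coe_addRight, Set.indicator, Set.mem_ofPred_eq, Pi.one_apply]
    congr 1
    rw [show w.1 (n + k) = w'.1 n from hk n])

lemma visits_proj (u : V) (w : Traj G) :
    visits u (proj w) = ∑' n : ℤ, {w : ℤ → V | w n = u}.indicator 1 w.1 := rfl

lemma measurable_visits (u : V) : Measurable (visits (G := G) u) := by
  refine measurable_from_quotient.2 ?_
  change Measurable fun w : Traj G => ∑' n : ℤ, {w : ℤ → V | w n = u}.indicator 1 w.1
  exact Measurable.tsum fun n =>
    (measurable_one.indicator (measurableSet_evalZ n u)).comp measurable_subtype_coe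

end Classes

/-! ### Densities with respect to the intensity measure -/

section Density

variable {V : Type*} {G : SimpleGraph V} [G.LocallyFinite] {a : V → V → ℝ≥0}
  [MeasurableSpace V] [DiscreteMeasurableSpace V] [Countable V]

/-- The escape probability in the equilibrium measure cancels the normalisation of the conditioned
past. If it vanishes, both sides are zero. -/
lemma equilibrium_smul_cond_prod (K : Finset V) (x : V) :
    equilibrium G a K x • (cond (walkLaw G a x) (noReturn K)).prod (walkLaw G a x)
      = (totalWeight G a x : ℝ≥0∞) •
        (pairLaw G a x).restrict (noReturn K ×ˢ (Set.univ : Set (ℕ → V))) := by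
  have h : (pairLaw G a x).restrict (noReturn K ×ˢ (Set.univ : Set (ℕ → V)))
      = ((walkLaw G a x).restrict (noReturn K)).prod (walkLaw G a x) := by
    rw [pairLaw, ← Measure.prod_restrict, Measure.restrict_univ]
  rw [h, ProbabilityTheory.cond, Measure.prod_smul_left, smul_smul, equilibrium]
  by_cases h0 : walkLaw G a x (noReturn K) = 0
  · rw [Measure.restrict_eq_zero.2 h0, Measure.zero_prod, smul_zero, smul_zero]
  · rw [mul_assoc, ENNReal.mul_inv_cancel h0 (measure_ne_top _ _), mul_one]

lemma nuOn_map_proj (w₀ : TrajMod G) (K : Finset V) :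
    (nuOn G a K).map proj = ((∑ x ∈ K, (totalWeight G a x : ℝ≥0∞) •
      ((pairLaw G a x).restrict (noReturn K ×ˢ (Set.univ : Set (ℕ → V)))).map glue).restrict
        (trajSet G)).map (mk w₀) := by
  rw [nuOn, map_proj_comap_val w₀]
  have : ∀ x, equilibrium G a K x • ((ProbabilityTheory.cond (walkLaw G a x) (noReturn K)).prod
      (walkLaw G a x)).map glue = (totalWeight G a x : ℝ≥0∞) •
      ((pairLaw G a x).restrict (noReturn K ×ˢ (Set.univ : Set (ℕ → V)))).map glue := fun x => by
    rw [← Measure.map_smul, equilibrium_smul_cond_prod, Measure.map_smul]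
  simp_rw [this]

variable (G a) in
/-- The law of the class modulo shift of the two-sided walk through `x`. -/
def classLaw (w₀ : TrajMod G) (x : V) : Measure (TrajMod G) :=
  (pairLaw G a x).map (fun p => mk w₀ (glue p))

lemma measurable_mk_glue (w₀ : TrajMod G) :
    Measurable fun p : (ℕ → V) × (ℕ → V) => mk w₀ (glue p) :=
  (measurable_mk w₀).comp measurable_glue

instance (w₀ : TrajMod G) (x : V) : IsProbabilityMeasure (classLaw G a w₀ x) :=
  Measure.isProbabilityMeasure_map (measurable_mk_glue w₀).aemeasurable

/-- The intensity measure is absolutely continuous with respect to the two-sided walks. -/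
lemma nu_eq_zero (w₀ : TrajMod G) {D : Set (TrajMod G)} (hD : MeasurableSet D)
    (h : ∀ x, classLaw G a w₀ x D = 0) : nu G a D = 0 := by
  -- For null sets the supremum over `K` may be replaced by the much larger sum.
  have h1 : nu G a ≤ Measure.sum fun K : Finset V => (nuOn G a K).map proj :=
    iSup_le fun K => Measure.le_sum _ K
  refine le_antisymm ((h1 D).trans ?_) zero_le
  rw [Measure.sum_apply _ hD, nonpos_iff_eq_zero, ENNReal.tsum_eq_zero]
  intro K
  rw [nuOn_map_proj w₀, Measure.map_apply (measurable_mk w₀) hD]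
  refine le_antisymm ((Measure.restrict_le_self _).trans ?_) zero_le
  rw [Measure.finsetSum_apply, nonpos_iff_eq_zero]
  refine Finset.sum_eq_zero fun x _ => ?_
  have hx := h x
  rw [classLaw, Measure.map_apply (measurable_mk_glue w₀) hD] at hx
  rw [Measure.smul_apply, Measure.map_apply measurable_glue (measurable_mk w₀ hD)]
  have : ((pairLaw G a x).restrict (noReturn K ×ˢ (Set.univ : Set (ℕ → V))))
      (glue ⁻¹' (mk w₀ ⁻¹' D)) = 0 :=
    le_antisymm ((Measure.restrict_le_self _).trans hx.le) zero_le
  rw [this, smul_zero]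

lemma ae_glue_mem_trajSet (hgood : ∀ x, ∀ᵐ w ∂walkLaw G a x, w ∈ goodPaths G) (x : V) :
    ∀ᵐ p ∂pairLaw G a x, glue p ∈ trajSet G ∧ p.1 0 = x ∧ p.1 ∈ goodPaths G := by
  filter_upwards [ae_pairLaw G a ((ae_walkLaw_zero G a x).and (hgood x))] with p hp
  exact ⟨glue_mem_trajSet (hp.1.1.trans hp.2.1.symm) hp.1.2 hp.2.2, hp.1.1, hp.1.2⟩

/-- The two-sided walk through `u` has at most the density "number of visits to `u`", up to the
factor `a_u`, with respect to the intensity measure. -/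
lemma smul_classLaw_le (ha_symm : ∀ x y, a x y = a y x) (ha : ∀ x, totalWeight G a x ≠ 0)
    (hgood : ∀ x, ∀ᵐ w ∂walkLaw G a x, w ∈ goodPaths G) (w₀ : TrajMod G) (u : V) :
    (totalWeight G a u : ℝ≥0∞) • classLaw G a w₀ u ≤ (nu G a).withDensity (visits u) := by
  refine Measure.le_iff.2 fun D hD => ?_
  rw [withDensity_apply _ hD, Measure.smul_apply, smul_eq_mul, classLaw,
    Measure.map_apply (measurable_mk_glue w₀) hD]
  set B : Set (ℤ → V) := trajSet G ∩ mk w₀ ⁻¹' D with hB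
  have hBm : MeasurableSet B := (measurableSet_trajSet G).inter (measurable_mk w₀ hD)
  have hBshift : ∀ (k : ℤ) (w : ℤ → V), shiftZ k w ∈ B ↔ w ∈ B := by
    intro k w
    simp only [hB, Set.mem_inter_iff, Set.mem_preimage, shiftZ_mem_trajSet_iff, mk_shiftZ]
  -- Trajectories of class in `D` that are at `u` at times `0`, `k` and `l`, with `l` the time of
  -- the first visit. The condition at time `0` is what reduces the stationary measure to the walk
  -- through `u`.
  let C : ℤ → ℤ → Set (ℤ → V) := fun k l =>
    B ∩ ({w | w 0 = u} ∩ ({w | w k = u} ∩ ({w | w l = u} ∩ ⋂ j : ℕ, {w | w (l - 1 - j) = u}ᶜ)))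
  have hCm : ∀ k l, MeasurableSet (C k l) := fun k l =>
    hBm.inter ((measurableSet_evalZ 0 u).inter ((measurableSet_evalZ k u).inter
      ((measurableSet_evalZ l u).inter
        (MeasurableSet.iInter fun j : ℕ => (measurableSet_evalZ (l - 1 - j) u).compl))))
  have hCshift : ∀ m : ℕ, shiftZ (m : ℤ) ⁻¹' (C 0 (-m)) = C m 0 := by
    intro m
    ext w
    have e : ∀ j : ℕ, -(m : ℤ) - 1 - j + m = 0 - 1 - j := fun j => by ring
    simp only [C, Set.mem_preimage, Set.mem_inter_iff, hBshift, Set.mem_ofPred_eq, Set.mem_iInter,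
      Set.mem_compl_iff]
    simp only [shiftZ, zero_add, neg_add_cancel, e]
    tauto
  -- By stationarity, seeing the first visit at time `-m` from a later visit at time `0` has the
  -- same mass as seeing a visit at time `m` from the first visit at time `0`.
  have htwo : ∀ m : ℕ, pairLaw G a u (glue ⁻¹' C m 0) = pairLaw G a u (glue ⁻¹' C 0 (-m)) := by
    intro m
    have h1 := lintegral_twoSided_shiftZ (G := G) ha_symm ha m
      (measurable_one.indicator (hCm 0 (-m)))
    have h2 : ∀ w, (C 0 (-m)).indicator (1 : (ℤ → V) → ℝ≥0∞) (shiftZ m w)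
        = (C m 0).indicator 1 w := by
      intro w
      rw [← hCshift]
      rfl
    simp_rw [h2] at h1
    rw [lintegral_indicator_one (hCm _ _), lintegral_indicator_one (hCm _ _),
      twoSided_apply_of_subset (hCm _ _) (u := u) fun w hw => hw.2.1,
      twoSided_apply_of_subset (hCm _ _) (u := u) fun w hw => hw.2.1] at h1
    exact (ENNReal.mul_right_inj (by exact_mod_cast ha u) ENNReal.coe_ne_top).1 h1
  -- Almost surely the past half has a last visit to `u`; in two-sided time this is the first visit,
  -- at some time `-m`.
  have hcover : pairLaw G a u ((fun p => mk w₀ (glue p)) ⁻¹' D)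
      ≤ ∑' m : ℕ, pairLaw G a u (glue ⁻¹' C m 0) := by
    simp_rw [htwo]
    refine le_trans (measure_mono_ae ?_) (measure_iUnion_le _)
    filter_upwards [ae_glue_mem_trajSet hgood u] with p hp hpD
    obtain ⟨m, hm⟩ := exists_mem_lastVisit (y := u) ⟨0, hp.2.1⟩ (hp.2.2.2 u)
    rw [mem_lastVisit] at hm
    refine Set.mem_iUnion.2 ⟨m, ⟨hp.1, hpD⟩, ?_, ?_, ?_, ?_⟩
    · simpa [glue] using hp.2.1
    · simpa [glue] using hp.2.1
    · exact (glue_nonpos p m).trans hm.1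
    · refine Set.mem_iInter.2 fun j hj => hm.2 (m + 1 + j) (by omega) ?_
      rw [← glue_nonpos]
      have e : -((m + 1 + j : ℕ) : ℤ) = -(m : ℤ) - 1 - j := by push_cast; ring
      rw [e]
      exact hj
  have hnu : (nuOn G a {u}).map proj ≤ nu G a := le_iSup (fun K => (nuOn G a K).map proj) {u}
  calc (totalWeight G a u : ℝ≥0∞) * pairLaw G a u ((fun p => mk w₀ (glue p)) ⁻¹' D)
      ≤ totalWeight G a u * ∑' m : ℕ, pairLaw G a u (glue ⁻¹' C m 0) := by gcongr
    _ ≤ ∫⁻ w in D, visits u w ∂(nuOn G a {u}).map proj := ?_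
    _ ≤ ∫⁻ w in D, visits u w ∂nu G a :=
        lintegral_mono' (Measure.restrict_mono le_rfl hnu) le_rfl
  rw [nuOn_map_proj w₀, Finset.sum_singleton, setLIntegral_map hD (measurable_visits u)
    (measurable_mk w₀), Measure.restrict_restrict (measurable_mk w₀ hD),
    Measure.restrict_smul, lintegral_smul_measure, smul_eq_mul, Set.inter_comm, ← hB,
    setLIntegral_map (f := fun w => visits u (mk w₀ w)) hBm
      ((measurable_visits u).comp (measurable_mk w₀)) measurable_glue,
    Measure.restrict_restrict (measurable_glue hBm)]
  gcongr
  have hEm : MeasurableSet (glue ⁻¹' B ∩ noReturn {u} ×ˢ (Set.univ : Set (ℕ → V))) :=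
    (measurable_glue hBm).inter ((measurableSet_noReturn {u}).prod MeasurableSet.univ)
  -- Under the measure for `K = {u}` time `0` is the first visit, so nothing is lost by counting
  -- visits at times `m ≥ 0` only.
  have hsum : ∀ p ∈ glue ⁻¹' B ∩ noReturn {u} ×ˢ (Set.univ : Set (ℕ → V)),
      ∑' m : ℕ, {w : ℤ → V | w m = u}.indicator 1 (glue p) ≤ visits u (mk w₀ (glue p)) := by
    intro p hp
    rw [mk_of_mem w₀ hp.1.1, visits_proj]
    exact ENNReal.tsum_comp_le_tsum_of_injective Nat.cast_injective
      (fun n : ℤ => {w : ℤ → V | w n = u}.indicator (1 : (ℤ → V) → ℝ≥0∞) (glue p))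
  refine le_trans ?_ (setLIntegral_mono ((measurable_visits u).comp
    (measurable_mk_glue w₀)) hsum)
  have hind : ∀ m : ℕ, Measurable fun p : (ℕ → V) × (ℕ → V) =>
      {w : ℤ → V | w m = u}.indicator (1 : (ℤ → V) → ℝ≥0∞) (glue p) := fun m =>
    (measurable_one.indicator (measurableSet_evalZ m u)).comp measurable_glue
  rw [lintegral_tsum fun m => (hind m).aemeasurable]
  refine ENNReal.tsum_le_tsum fun m => ?_
  have : ∀ p, {w : ℤ → V | w m = u}.indicator (1 : (ℤ → V) → ℝ≥0∞) (glue p)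
      = (glue ⁻¹' {w : ℤ → V | w m = u}).indicator 1 p := fun p => rfl
  simp_rw [this]
  rw [lintegral_indicator_one (measurable_glue (measurableSet_evalZ m u)),
    Measure.restrict_apply (measurable_glue (measurableSet_evalZ m u))]
  refine measure_mono fun p hp => ?_
  obtain ⟨h1, h2, h3, h4, h5⟩ := hp
  refine ⟨h3, h1, ?_, Set.mem_univ _⟩
  intro n hn hn'
  refine Set.mem_iInter.1 h5 (n - 1) ?_
  have e : (0 : ℤ) - 1 - ((n - 1 : ℕ) : ℤ) = -(n : ℤ) := by omega
  change glue p (0 - 1 - ((n - 1 : ℕ) : ℤ)) = u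
  rw [e, glue_nonpos]
  simpa using hn'

variable (G a) in
/-- The law of the class of the two-sided walk through the position at time `n` of the walk
started from `o`. -/
def mixLaw (w₀ : TrajMod G) (o : V) (n : ℕ) : Measure (TrajMod G) :=
  Measure.sum fun u => transProb G a n o u • classLaw G a w₀ u

variable (G a) in
/-- An upper bound for the density of `mixLaw` with respect to the intensity measure. -/
def mixDensity (o : V) (n : ℕ) (w : TrajMod G) : ℝ≥0∞ :=
  ∑' u, transProb G a n u o / totalWeight G a o * visits u w

instance (w₀ : TrajMod G) (o : V) (n : ℕ) : IsProbabilityMeasure (mixLaw G a w₀ o n) := by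
  constructor
  rw [mixLaw, Measure.sum_apply _ MeasurableSet.univ]
  simp only [Measure.smul_apply, measure_univ, smul_eq_mul, mul_one]
  have hU : (Set.univ : Set (ℕ → V)) = ⋃ u, {w | w n = u} := by ext w; simp
  rw [← measure_univ (μ := walkLaw G a o), hU, measure_iUnion]
  · rfl
  · intro z z' hzz'
    exact Set.disjoint_left.2 fun w (hw : w n = z) (hw' : w n = z') => hzz' (hw.symm.trans hw')
  · exact fun z => measurableSet_eval n z

/-- Reversibility replaces the weight `p_n(o,u)` by `p_n(u,o) a_u / a_o`; the factor `a_u` is the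
one needed to compare the walk through `u` with the intensity. -/
lemma mixLaw_le (ha_symm : ∀ x y, a x y = a y x) (ha : ∀ x, totalWeight G a x ≠ 0)
    (hgood : ∀ x, ∀ᵐ w ∂walkLaw G a x, w ∈ goodPaths G) (w₀ : TrajMod G) (o : V) (n : ℕ) :
    mixLaw G a w₀ o n ≤ (nu G a).withDensity (mixDensity G a o n) := by
  refine Measure.le_iff.2 fun D hD => ?_
  rw [mixLaw, Measure.sum_apply _ hD, withDensity_apply _ hD]
  simp only [mixDensity]
  rw [lintegral_tsum fun u => ((measurable_visits u).const_mul _).aemeasurable]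
  refine ENNReal.tsum_le_tsum fun u => ?_
  rw [lintegral_const_mul _ (measurable_visits u), ← withDensity_apply _ hD]
  have h' : ∀ x, (totalWeight G a x : ℝ≥0∞) ≠ 0 := fun x => by exact_mod_cast ha x
  have h1 : transProb G a n o u
      = transProb G a n u o / totalWeight G a o * totalWeight G a u := by
    rw [div_eq_mul_inv, mul_right_comm, mul_comm (transProb G a n u o),
      totalWeight_mul_transProb ha_symm ha, mul_comm, ← mul_assoc,
      ENNReal.inv_mul_cancel (h' o) ENNReal.coe_ne_top, one_mul]
  rw [h1, mul_smul, Measure.smul_apply, smul_eq_mul]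
  exact mul_le_mul_right (smul_classLaw_le ha_symm ha hgood w₀ u D) _

/-- Each half of the two-sided walk contributes at most one Green function; the visit at time `0`
may be counted in both halves. -/
lemma lintegral_visits_le (hgood : ∀ x, ∀ᵐ w ∂walkLaw G a x, w ∈ goodPaths G) (w₀ : TrajMod G)
    (u v : V) : ∫⁻ w, visits u w ∂classLaw G a w₀ v ≤ 2 * green G a v u := by
  classical
  rw [classLaw, lintegral_map (measurable_visits u) (measurable_mk_glue w₀)]
  have hm : ∀ j : ℕ, Measurable ({w : ℕ → V | w j = u}.indicator (1 : (ℕ → V) → ℝ≥0∞)) :=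
    fun j => measurable_one.indicator (measurableSet_eval j u)
  let S : (ℕ → V) → ℝ≥0∞ := fun w => ∑' j : ℕ, {w : ℕ → V | w j = u}.indicator 1 w
  have hle : ∀ᵐ p ∂pairLaw G a v, visits u (mk w₀ (glue p)) ≤ S p.2 + S p.1 := by
    filter_upwards [ae_pairLaw G a ((ae_walkLaw_zero G a v).and (hgood v))] with p hp
    have h0 : p.1 0 = p.2 0 := hp.1.1.trans hp.2.1.symm
    rw [mk_of_mem w₀ (glue_mem_trajSet h0 hp.1.2 hp.2.2), visits_proj,
      tsum_of_nat_of_neg_add_one ENNReal.summable ENNReal.summable]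
    refine add_le_add (le_of_eq (tsum_congr fun j => ?_)) ?_
    · simp only [Set.indicator, Set.mem_ofPred_eq, glue_nonneg p h0, Pi.one_apply]
    · refine le_trans (le_of_eq (tsum_congr fun j => ?_))
        (ENNReal.tsum_comp_le_tsum_of_injective (add_left_injective 1) _)
      have e : -((j : ℤ) + 1) = -((j + 1 : ℕ) : ℤ) := by push_cast; ring
      simp only [Set.indicator, Set.mem_ofPred_eq, e, glue_nonpos, Pi.one_apply]
  refine (lintegral_mono_ae hle).trans ?_
  have h1 : ∀ j, ∫⁻ w, {w : ℕ → V | w j = u}.indicator 1 w ∂walkLaw G a v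
      = transProb G a j v u := fun j => lintegral_indicator_one (measurableSet_eval j u)
  have hg : ∫⁻ w, S w ∂walkLaw G a v = green G a v u := by
    rw [lintegral_tsum fun j => (hm j).aemeasurable]
    exact tsum_congr h1
  have hS : Measurable S := Measurable.tsum hm
  rw [lintegral_add_left (f := fun p : (ℕ → V) × (ℕ → V) => S p.2) (hS.comp measurable_snd),
    pairLaw, lintegral_prod (fun p : (ℕ → V) × (ℕ → V) => S p.2)
      (hS.comp measurable_snd).aemeasurable,
    lintegral_prod (fun p : (ℕ → V) × (ℕ → V) => S p.1) (hS.comp measurable_fst).aemeasurable]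
  simp only [lintegral_const, measure_univ, mul_one, hg]
  rw [two_mul]

/-- The expected visits between the random positions `v` and `u` give `p_n(o,v) g(v,u) p_n(u,o)` up
to a factor. Summed over `u` and `v`, Chapman–Kolmogorov turns this into return probabilities to `o`
at times at least `2n`. -/
lemma lintegral_mixDensity_le (hgood : ∀ x, ∀ᵐ w ∂walkLaw G a x, w ∈ goodPaths G)
    (w₀ : TrajMod G) (o : V) (n : ℕ) :
    ∫⁻ w, mixDensity G a o n w ∂mixLaw G a w₀ o n
      ≤ 2 / totalWeight G a o * ∑' k, transProb G a (k + 2 * n) o o := by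
  rw [mixLaw, lintegral_sum_measure]
  have h1 : ∀ v, ∫⁻ w, mixDensity G a o n w ∂(transProb G a n o v • classLaw G a w₀ v)
      ≤ 2 / totalWeight G a o * ∑' k, ∑' u, transProb G a n o v *
        (transProb G a k v u * transProb G a n u o) := by
    intro v
    rw [lintegral_smul_measure, smul_eq_mul]
    simp only [mixDensity]
    rw [lintegral_tsum fun u => ((measurable_visits u).const_mul _).aemeasurable,
      ENNReal.tsum_comm, ← ENNReal.tsum_mul_left, ← ENNReal.tsum_mul_left]
    refine ENNReal.tsum_le_tsum fun u => ?_
    rw [lintegral_const_mul _ (measurable_visits u)]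
    calc transProb G a n o v * (transProb G a n u o / totalWeight G a o
          * ∫⁻ w, visits u w ∂classLaw G a w₀ v)
        ≤ transProb G a n o v * (transProb G a n u o / totalWeight G a o
          * (2 * green G a v u)) := by gcongr; exact lintegral_visits_le hgood w₀ u v
      _ = 2 / totalWeight G a o *
          (transProb G a n o v * (green G a v u * transProb G a n u o)) := by
          simp only [div_eq_mul_inv]; ring
      _ = _ := by rw [green, ← ENNReal.tsum_mul_right, ← ENNReal.tsum_mul_left]
  refine (ENNReal.tsum_le_tsum h1).trans ?_
  rw [ENNReal.tsum_mul_left]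
  gcongr
  rw [ENNReal.tsum_comm]
  refine ENNReal.tsum_le_tsum fun k => ?_
  have e : k + 2 * n = n + (k + n) := by ring
  rw [e, chapman_kolmogorov]
  refine ENNReal.tsum_le_tsum fun v => ?_
  rw [chapman_kolmogorov, ENNReal.tsum_mul_left]

lemma tendsto_lintegral_mixDensity (ha : ∀ x, totalWeight G a x ≠ 0)
    (hgood : ∀ x, ∀ᵐ w ∂walkLaw G a x, w ∈ goodPaths G)
    (w₀ : TrajMod G) (o : V) (hgreen : green G a o o ≠ ∞) :
    Filter.Tendsto (fun n => ∫⁻ w, mixDensity G a o n w ∂mixLaw G a w₀ o n)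
      Filter.atTop (nhds 0) := by
  have h1 := (ENNReal.tendsto_sum_nat_add (fun k => transProb G a k o o) hgreen).comp
    (Filter.tendsto_id.const_mul_atTop' (two_pos : 0 < 2))
  have h2 : (2 / totalWeight G a o : ℝ≥0∞) ≠ ∞ :=
    ENNReal.div_ne_top (by simp) (by exact_mod_cast ha o)
  have h3 := ENNReal.Tendsto.const_mul h1 (Or.inr h2)
  rw [mul_zero] at h3
  exact tendsto_of_tendsto_of_tendsto_of_le_of_le tendsto_const_nhds h3 (fun _ => zero_le)
    (fun n => lintegral_mixDensity_le hgood w₀ o n)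

end Density

/-! ### Point configurations, their counts and insertion of a point -/

section Configurations

variable {V : Type*} {G : SimpleGraph V} [MeasurableSpace V]

/-- A measurable set of classes whose members all visit a common finite set. -/
def BddSet (D : Set (TrajMod G)) : Prop := MeasurableSet D ∧ ∃ K, D ⊆ hitSet G K

lemma BddSet.mono {D D' : Set (TrajMod G)} (h : BddSet D) (hD' : MeasurableSet D')
    (hs : D' ⊆ D) : BddSet D' :=
  ⟨hD', h.2.imp fun _ hK => hs.trans hK⟩

lemma bddSet_empty : BddSet (∅ : Set (TrajMod G)) :=
  ⟨MeasurableSet.empty, ∅, Set.empty_subset _⟩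

lemma BddSet.apply_lt_top {D : Set (TrajMod G)} (h : BddSet D) (ω : Config G) : ω.1 D < ∞ := by
  obtain ⟨K, hK⟩ := h.2
  exact (measure_mono hK).trans_lt (ω.2.2 K)

/-- A sum of point masses counts the indices whose point lies in `D`, and local finiteness excludes
an infinite count. -/
lemma BddSet.exists_nat {D : Set (TrajMod G)} (h : BddSet D) (ω : Config G) :
    ∃ k : ℕ, ω.1 D = k := by
  have hlt := h.apply_lt_top ω
  obtain ⟨I, w, hw⟩ := ω.2.1
  have h1 : ω.1 D = ((w ⁻¹' D).encard : ℕ∞) := by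
    rw [hw, Measure.sum_apply _ h.1, ← ENNReal.tsum_set_one, tsum_subtype (w ⁻¹' D) fun _ => 1]
    refine tsum_congr fun i => ?_
    rw [Measure.dirac_apply' _ h.1]
    rfl
  rw [h1] at hlt ⊢
  have h2 : (w ⁻¹' D).encard ≠ ⊤ := by
    intro ht
    rw [ht] at hlt
    simp at hlt
  obtain ⟨k, hk⟩ := ENat.ne_top_iff_exists.1 h2
  exact ⟨k, by rw [← hk]; rfl⟩

lemma proj_mem_hitSet {K : Finset V} {w : Traj G} : proj w ∈ hitSet G K ↔ Hits K w := by
  constructor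
  · rintro ⟨w', hw', h⟩
    obtain ⟨k, hk⟩ := Quotient.exact (s := shiftSetoid G) h
    exact (hits_shift hk).1 hw'
  · intro h
    exact ⟨w, h, rfl⟩

variable (G) in
lemma measurable_apply_config {D : Set (TrajMod G)} (hD : MeasurableSet D) :
    Measurable fun ω : Config G => ω.1 D :=
  (Measure.measurable_coe hD).comp measurable_subtype_coe

variable [DiscreteMeasurableSpace V]

variable (G) in
lemma measurableSet_hits (K : Finset V) : MeasurableSet {w : Traj G | Hits K w} := by
  have : {w : Traj G | Hits K w} = ⋃ n : ℤ, (fun w : Traj G => w.1 n) ⁻¹' (K : Set V) := by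
    ext w; simp [Hits]
  rw [this]
  exact MeasurableSet.iUnion fun n =>
    ((measurable_pi_apply n).comp measurable_subtype_coe) MeasurableSet.of_discrete

variable (G) in
lemma measurableSet_hitSet (K : Finset V) : MeasurableSet (hitSet G K) := by
  rw [measurableSet_quotient]
  convert measurableSet_hits G K using 1
  ext w
  exact proj_mem_hitSet

variable (G) in
lemma bddSet_hitSet (K : Finset V) : BddSet (hitSet G K) :=
  ⟨measurableSet_hitSet G K, K, subset_rfl⟩

variable (G) in
-- Classify a trajectory by the first vertex of a fixed enumeration that it visits. The bounded
-- cells give σ-finiteness and reduce identities of measures to bounded sets.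
lemma exists_cells [Countable V] [Nonempty V] : ∃ S : ℕ → Set (TrajMod G),
    (∀ n, BddSet (S n)) ∧ Pairwise (Function.onFun Disjoint S) ∧ ⋃ n, S n = Set.univ := by
  obtain ⟨e, he⟩ := exists_surjective_nat V
  have hm : ∀ n, MeasurableSet (disjointed (fun n => hitSet G {e n}) n) :=
    MeasurableSet.disjointed fun n => measurableSet_hitSet G {e n}
  refine ⟨disjointed fun n => hitSet G {e n}, fun n => (bddSet_hitSet G {e n}).mono (hm n)
    (disjointed_subset _ n), disjoint_disjointed _, ?_⟩
  rw [iUnion_disjointed]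
  refine Set.eq_univ_of_forall fun c => ?_
  induction c using Quotient.inductionOn with
  | h w =>
    obtain ⟨n, hn⟩ := he (w.1 0)
    refine Set.mem_iUnion.2 ⟨n, proj_mem_hitSet.2 ⟨0, ?_⟩⟩
    simp [hn]

lemma measure_eq_tsum_cells {S : ℕ → Set (TrajMod G)} (hS : ∀ n, BddSet (S n))
    (hd : Pairwise (Function.onFun Disjoint S)) (hU : ⋃ n, S n = Set.univ)
    (μ : Measure (TrajMod G)) {D : Set (TrajMod G)} (hD : MeasurableSet D) :
    μ D = ∑' n, μ (D ∩ S n) := by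
  rw [← measure_iUnion (fun i j hij => (hd hij).mono Set.inter_subset_right
    Set.inter_subset_right) fun n => hD.inter (hS n).1, ← Set.inter_iUnion, hU, Set.inter_univ]

/-- The configurations with `k i` points in `C i`, for all `i`. -/
def countEvent {ι : Type*} (C : ι → Set (TrajMod G)) (k : ι → ℕ) : Set (Config G) :=
  {ω | ∀ i, ω.1 (C i) = k i}

lemma measurableSet_countEvent {ι : Type*} [Countable ι] {C : ι → Set (TrajMod G)}
    (hC : ∀ i, MeasurableSet (C i)) (k : ι → ℕ) : MeasurableSet (countEvent C k) := by
  have : countEvent C k = ⋂ i, (fun ω : Config G => ω.1 (C i)) ⁻¹' {(k i : ℝ≥0∞)} := by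
    ext ω; simp [countEvent]
  rw [this]
  exact MeasurableSet.iInter fun i =>
    measurable_apply_config G (hC i) (measurableSet_singleton _)

/-- The events that prescribe the number of points in finitely many bounded sets. -/
def countPi (G : SimpleGraph V) : Set (Set (Config G)) :=
  {S | ∃ (s : Finset (Set (TrajMod G))) (k : Set (TrajMod G) → ℕ), (∀ D ∈ s, BddSet D) ∧
    S = {ω : Config G | ∀ D ∈ s, ω.1 D = (k D : ℝ≥0∞)}}

lemma measurableSet_of_mem_countPi {S : Set (Config G)} (hS : S ∈ countPi G) :
    MeasurableSet S := by
  obtain ⟨s, k, hs, rfl⟩ := hS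
  have : {ω : Config G | ∀ D ∈ s, ω.1 D = (k D : ℝ≥0∞)}
      = ⋂ D ∈ s, (fun ω : Config G => ω.1 D) ⁻¹' {(k D : ℝ≥0∞)} := by
    ext ω; simp
  rw [this]
  exact s.measurableSet_biInter fun D hD =>
    measurable_apply_config G (hs D hD).1 (measurableSet_singleton _)

lemma isPiSystem_countPi : IsPiSystem (countPi G) := by
  classical
  rintro _ ⟨s, k, hs, rfl⟩ _ ⟨s', k', hs', rfl⟩ ⟨ω₀, h₀, h₀'⟩
  -- On sets common to `s` and `s'` the prescribed counts agree, because the intersection contains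
  -- some configuration.
  refine ⟨s ∪ s', fun D => if D ∈ s then k D else k' D, ?_, ?_⟩
  · intro D hD
    rcases Finset.mem_union.1 hD with h | h
    · exact hs D h
    · exact hs' D h
  · ext ω
    simp only [Set.mem_inter_iff, Set.mem_ofPred_eq, Finset.mem_union]
    constructor
    · rintro ⟨h, h'⟩ D hD
      by_cases hDs : D ∈ s
      · simp [hDs, h D hDs]
      · simp [hDs, h' D (hD.resolve_left hDs)]
    · intro h
      refine ⟨fun D hD => by simpa [hD] using h D (Or.inl hD), fun D hD => ?_⟩
      by_cases hDs : D ∈ s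
      · have h1 := h D (Or.inl hDs)
        simp only [hDs, if_true] at h1
        rw [h1, ← h₀ D hDs, h₀' D hD]
      · simpa [hDs] using h D (Or.inr hD)

/-- Counts in bounded sets take countably many values, so prescribing them makes these counts
measurable; the count in a general set is a sum over the cells. -/
lemma generateFrom_countPi [Countable V] [Nonempty V] :
    (inferInstance : MeasurableSpace (Config G)) = MeasurableSpace.generateFrom (countPi G) := by
  refine le_antisymm ?_ (MeasurableSpace.generateFrom_le ?_)
  · obtain ⟨S, hS, hd, hU⟩ := exists_cells G
    have hm : Measurable[MeasurableSpace.generateFrom (countPi G)]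
        (Subtype.val : Config G → Measure (TrajMod G)) := by
      let : MeasurableSpace (Config G) := MeasurableSpace.generateFrom (countPi G)
      refine Measure.measurable_of_measurable_coe _ fun D hD => ?_
      have hb : ∀ D : Set (TrajMod G), BddSet D → Measurable fun ω : Config G => ω.1 D := by
        intro D hD T _
        have : (fun ω : Config G => ω.1 D) ⁻¹' T
            = ⋃ k : {k : ℕ // (k : ℝ≥0∞) ∈ T}, {ω : Config G | ω.1 D = (k : ℕ)} := by
          ext ω
          simp only [Set.mem_preimage, Set.mem_iUnion, Set.mem_ofPred_eq]
          constructor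
          · intro h
            obtain ⟨k, hk⟩ := hD.exists_nat ω
            exact ⟨⟨k, hk ▸ h⟩, hk⟩
          · rintro ⟨⟨k, hk'⟩, hk⟩
            rw [hk]; exact hk'
        rw [this]
        refine MeasurableSet.iUnion fun k => MeasurableSpace.measurableSet_generateFrom
          ⟨{D}, fun _ => (k : ℕ), by simpa using hD, by simp⟩
      simp_rw [fun ω : Config G => measure_eq_tsum_cells hS hd hU ω.1 hD]
      exact Measurable.tsum fun n => hb _ ((hS n).mono (hD.inter (hS n).1) Set.inter_subset_right)
    exact hm.comap_le
  · exact fun S hS => measurableSet_of_mem_countPi hS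

/-- A finite measure on configurations is determined by the joint laws of the numbers of points in
finitely many disjoint bounded sets; one may assume that a given bounded set is a union of some of
these sets. -/
lemma ext_of_countEvent [Countable V] [Nonempty V] {Q₁ Q₂ : Measure (Config G)} [IsFiniteMeasure Q₁]
    {D₀ : Set (TrajMod G)} (hD₀ : BddSet D₀)
    (h : ∀ (m : ℕ) (C : Fin m → Set (TrajMod G)), (∀ i, BddSet (C i)) →
      Pairwise (Function.onFun Disjoint C) → (∃ I : Finset (Fin m), D₀ = ⋃ i ∈ I, C i) →
      ∀ k : Fin m → ℕ, Q₁ (countEvent C k) = Q₂ (countEvent C k)) : Q₁ = Q₂ := by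
  classical
  have key : ∀ S ∈ countPi G, Q₁ S = Q₂ S := by
    rintro _ ⟨s, k, hs, rfl⟩
    set t := insert D₀ s with ht
    have htb : ∀ D ∈ t, BddSet D := by
      intro D hD
      rcases Finset.mem_insert.1 hD with rfl | hD
      · exact hD₀
      · exact hs D hD
    -- The atoms of the family `t` are indexed by the sets of members that contain a given point.
    -- The empty index is left out, since its atom lies outside all members and need not be bounded.
    let 𝒥 := t.powerset.erase ∅
    let e := 𝒥.equivFin
    let J : Fin 𝒥.card → Finset (Set (TrajMod G)) := fun i => (e.symm i).1
    have hJt : ∀ i, J i ⊆ t := fun i =>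
      Finset.mem_powerset.1 (Finset.mem_of_mem_erase (e.symm i).2)
    let C : Fin 𝒥.card → Set (TrajMod G) := fun i => {x | ∀ D ∈ t, x ∈ D ↔ D ∈ J i}
    have hCm : ∀ i, MeasurableSet (C i) := by
      intro i
      have : C i = ⋂ D ∈ t, {x | x ∈ D ↔ D ∈ J i} := by ext x; simp [C]
      rw [this]
      refine t.measurableSet_biInter fun D hD => ?_
      by_cases hDi : D ∈ J i
      · have : {x | x ∈ D ↔ D ∈ J i} = D := by ext x; simp [hDi]
        rw [this]; exact (htb D hD).1
      · have : {x | x ∈ D ↔ D ∈ J i} = Dᶜ := by ext x; simp [hDi]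
        rw [this]; exact (htb D hD).1.compl
    have hCb : ∀ i, BddSet (C i) := by
      intro i
      obtain ⟨D, hD⟩ := Finset.nonempty_iff_ne_empty.2 (Finset.ne_of_mem_erase (e.symm i).2)
      exact (htb D (hJt i hD)).mono (hCm i) fun x hx => (hx D (hJt i hD)).2 hD
    have hCd : Pairwise (Function.onFun Disjoint C) := by
      intro i j hij
      refine Set.disjoint_left.2 fun x hx hx' => hij ?_
      have : J i = J j := by
        ext D
        by_cases hD : D ∈ t
        · exact (hx D hD).symm.trans (hx' D hD)
        · exact iff_of_false (fun h => hD (hJt i h)) fun h => hD (hJt j h)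
      exact e.symm.injective (Subtype.ext this)
    have hDC : ∀ D ∈ t, D = ⋃ i ∈ Finset.univ.filter fun i => D ∈ J i, C i := by
      intro D hD
      ext x
      simp only [Set.mem_iUnion, Finset.mem_filter, Finset.mem_univ, true_and, exists_prop]
      constructor
      · intro hx
        have hmem : t.filter (fun D => x ∈ D) ∈ 𝒥 :=
          Finset.mem_erase.2 ⟨(Finset.nonempty_iff_ne_empty.1
            ⟨D, Finset.mem_filter.2 ⟨hD, hx⟩⟩), Finset.mem_powerset.2 (Finset.filter_subset _ _)⟩
        have hJe : J (e ⟨_, hmem⟩) = t.filter (fun D => x ∈ D) := by simp [J]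
        refine ⟨e ⟨_, hmem⟩, ?_, fun D' hD' => ?_⟩
        · rw [hJe]; exact Finset.mem_filter.2 ⟨hD, hx⟩
        · rw [hJe, Finset.mem_filter]; simp [hD']
      · rintro ⟨i, hi, hx⟩
        exact (hx D hD).2 hi
    have hωD : ∀ D ∈ t, ∀ ω : Config G,
        ω.1 D = ∑ i ∈ Finset.univ.filter fun i => D ∈ J i, ω.1 (C i) := by
      intro D hD ω
      conv_lhs => rw [hDC D hD]
      exact measure_biUnion_finset (fun i _ j _ hij => hCd hij) fun i _ => hCm i
    set S : Set (Config G) := {ω : Config G | ∀ D ∈ s, ω.1 D = (k D : ℝ≥0∞)} with hS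
    have hSm : MeasurableSet S := measurableSet_of_mem_countPi ⟨s, k, hs, rfl⟩
    -- Split according to the counts in the atoms. These determine the counts in all members of `s`,
    -- so each part is either empty or a full count event.
    have hcov : S = ⋃ κ : Fin 𝒥.card → ℕ, S ∩ countEvent C κ := by
      rw [← Set.inter_iUnion]
      refine (Set.inter_eq_left.2 fun ω _ => ?_).symm
      choose κ hκ using fun i => (hCb i).exists_nat ω
      exact Set.mem_iUnion.2 ⟨κ, hκ⟩
    have hdisj : Pairwise (Function.onFun Disjoint fun κ : Fin 𝒥.card → ℕ =>
        S ∩ countEvent C κ) := by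
      intro κ κ' hκ
      refine Set.disjoint_left.2 fun ω hω hω' => hκ ?_
      funext i
      exact_mod_cast (hω.2 i).symm.trans (hω'.2 i)
    rw [hcov, measure_iUnion hdisj fun κ => hSm.inter (measurableSet_countEvent hCm κ),
      measure_iUnion hdisj fun κ => hSm.inter (measurableSet_countEvent hCm κ)]
    refine tsum_congr fun κ => ?_
    rcases (S ∩ countEvent C κ).eq_empty_or_nonempty with he | ⟨ω, hω⟩
    · rw [he, measure_empty, measure_empty]
    · have : S ∩ countEvent C κ = countEvent C κ := by
        refine Set.inter_eq_right.2 fun ω' hω' D hD => ?_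
        have hDt : D ∈ t := Finset.mem_insert_of_mem hD
        rw [← hω.1 D hD, hωD D hDt, hωD D hDt]
        exact Finset.sum_congr rfl fun i _ => (hω' i).trans (hω.2 i).symm
      rw [this]
      exact h _ C hCb hCd ⟨_, hDC D₀ (Finset.mem_insert_self _ _)⟩ κ
  refine ext_of_generate_finite (countPi G) generateFrom_countPi isPiSystem_countPi key
    (key _ ⟨∅, fun _ => 0, by simp, by simp⟩)

/-- The configuration with one more point. -/
def addPt (ω : Config G) (w : TrajMod G) : Config G :=
  ⟨ω.1 + Measure.dirac w, by
    constructor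
    · obtain ⟨I, f, hf⟩ := ω.2.1
      have hpos : ∀ i ∈ insert 0 (Nat.succ '' I), i ≠ 0 → i - 1 ∈ I := by
        rintro i (rfl | ⟨j, hj, rfl⟩) h
        · exact absurd rfl h
        · exact hj
      classical
      -- The new point receives index `0` and the old indices are raised by one.
      refine ⟨insert 0 (Nat.succ '' I), fun i => if h : i.1 = 0 then w else
        f ⟨i.1 - 1, hpos i.1 i.2 h⟩, ?_⟩
      ext D hD
      rw [Measure.sum_apply _ hD, Measure.add_apply, hf, Measure.sum_apply _ hD]
      let F : ℕ → ℝ≥0∞ := fun i => if i = 0 then Measure.dirac w D else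
        if h : i - 1 ∈ I then Measure.dirac (f ⟨i - 1, h⟩) D else 0
      have hF : ∀ i : ↑(insert 0 (Nat.succ '' I) : Set ℕ),
          Measure.dirac (if h : i.1 = 0 then w else f ⟨i.1 - 1, hpos i.1 i.2 h⟩) D = F i := by
        intro i
        by_cases h : i.1 = 0
        · simp [F, h]
        · simp [F, h, hpos i.1 i.2 h]
      simp_rw [hF]
      rw [Set.insert_eq, ENNReal.summable.tsum_union_disjoint (by simp)
        ENNReal.summable, tsum_singleton, tsum_image F Nat.succ_injective.injOn, add_comm]
      congr 1
      refine tsum_congr fun i => ?_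
      simp [F]
    · intro K
      rw [Measure.add_apply]
      exact ENNReal.add_lt_top.2 ⟨ω.2.2 K, measure_lt_top _ _⟩⟩

lemma addPt_val (ω : Config G) (w : TrajMod G) : (addPt ω w).1 = ω.1 + Measure.dirac w := rfl

@[fun_prop]
lemma measurable_addPt : Measurable fun p : Config G × TrajMod G => addPt p.1 p.2 := by
  refine Measurable.subtype_mk ?_
  exact (measurable_subtype_coe.comp measurable_fst).add
    (Measure.measurable_dirac.comp measurable_snd)

end Configurations

/-! ### Poisson processes: the Mecke equation, a zero-one law and the cost of an insertion -/

lemma succ_mul_poissonMeasure (r : ℝ≥0) (k : ℕ) :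
    ((k + 1 : ℕ) : ℝ≥0∞) * poissonMeasure r {k + 1} = r * poissonMeasure r {k} := by
  rw [poissonMeasure_singleton, poissonMeasure_singleton, ← ENNReal.ofReal_natCast,
    ← ENNReal.ofReal_coe_nnreal, ← ENNReal.ofReal_mul (by positivity),
    ← ENNReal.ofReal_mul (by positivity)]
  congr 1
  rw [Nat.factorial_succ]
  push_cast
  field_simp
  ring

lemma poissonMeasure_singleton_zero_ne (r : ℝ≥0) : poissonMeasure r {0} ≠ 0 := by
  rw [poissonMeasure_singleton]
  simp only [ne_eq, ENNReal.ofReal_eq_zero, not_le]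
  positivity

section Mecke

variable {V : Type*} {G : SimpleGraph V} [MeasurableSpace V] [DiscreteMeasurableSpace V]
  {ν : Measure (TrajMod G)} {P : Measure (Config G)}

/-- An infinite intensity would force infinitely many points in `D`, against the local finiteness of
configurations. -/
lemma ae_ne_top_of_poisson (hP : IsPoissonPointProcess ν (fun ω : Config G => ω.1) P)
    {D : Set (TrajMod G)} (hD : BddSet D) : ν D ≠ ∞ := by
  intro h
  have := hP.isProbabilityMeasure
  obtain ⟨ω, hω⟩ := (hP.infinite D hD.1 h).exists
  exact (hD.apply_lt_top ω).ne hω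

lemma sigmaFinite_of_poisson [Countable V] [Nonempty V]
    (hP : IsPoissonPointProcess ν (fun ω : Config G => ω.1) P) : SigmaFinite ν := by
  obtain ⟨S, hS, -, hU⟩ := exists_cells G
  exact ⟨⟨⟨S, fun _ => trivial, fun n => (ae_ne_top_of_poisson hP (hS n)).lt_top, hU⟩⟩⟩

lemma poisson_countEvent (hP : IsPoissonPointProcess ν (fun ω : Config G => ω.1) P) {m : ℕ}
    {C : Fin m → Set (TrajMod G)} (hC : ∀ i, BddSet (C i))
    (hd : Pairwise (Function.onFun Disjoint C)) (k : Fin m → ℕ) :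
    P (countEvent C k) = ∏ i, poissonMeasure (ν (C i)).toNNReal {k i} := by
  have h1 := (hP.indep m C (fun i => (hC i).1) hd).measure_inter_preimage_eq_mul Finset.univ
    (sets := fun i => {(k i : ℝ≥0∞)}) fun i _ => measurableSet_singleton _
  have h2 : countEvent C k
      = ⋂ i ∈ Finset.univ, (fun ω : Config G => ω.1 (C i)) ⁻¹' {(k i : ℝ≥0∞)} := by
    ext ω; simp [countEvent]
  rw [h2, h1]
  refine Finset.prod_congr rfl fun i _ => ?_
  rw [← Measure.map_apply (measurable_apply_config G (hC i).1) (measurableSet_singleton _),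
    hP.poisson _ (hC i).1 (ae_ne_top_of_poisson hP (hC i)),
    Measure.map_apply Measurable.of_discrete (measurableSet_singleton _)]
  congr 1
  ext j
  simp

lemma addPt_mem_countEvent {m : ℕ} {C : Fin m → Set (TrajMod G)} (hC : ∀ i, BddSet (C i))
    (hd : Pairwise (Function.onFun Disjoint C)) (k : Fin m → ℕ) {i : Fin m} {w : TrajMod G}
    (hw : w ∈ C i) (ω : Config G) :
    addPt ω w ∈ countEvent C k ↔ k i ≠ 0 ∧ ω ∈ countEvent C (Function.update k i (k i - 1)) := by
  classical
  have hval : ∀ j, (addPt ω w).1 (C j) = ω.1 (C j) + if j = i then 1 else 0 := by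
    intro j
    rw [addPt_val, Measure.add_apply, Measure.dirac_apply' _ (hC j).1]
    congr 1
    by_cases h : j = i
    · subst h; simp [hw]
    · have : w ∉ C j := fun h' => Set.disjoint_left.1 (hd h) h' hw
      simp [h, this]
  simp only [countEvent, Set.mem_ofPred_eq, hval]
  constructor
  · intro h
    have hi := h i
    obtain ⟨n, hn⟩ := (hC i).exists_nat ω
    rw [if_pos rfl, hn] at hi
    have hi' : n + 1 = k i := by exact_mod_cast hi
    refine ⟨by omega, fun j => ?_⟩
    by_cases hj : j = i
    · subst hj
      rw [Function.update_self, hn]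
      congr 1
      omega
    · rw [Function.update_of_ne hj]
      simpa [hj] using h j
  · rintro ⟨h0, h⟩ j
    by_cases hj : j = i
    · subst hj
      rw [if_pos rfl, h j, Function.update_self]
      have : ((k j - 1 : ℕ) : ℝ≥0∞) + 1 = ((k j - 1 + 1 : ℕ) : ℝ≥0∞) := by push_cast; rfl
      rw [this]
      congr 1
      omega
    · have := h j
      rw [Function.update_of_ne hj] at this
      simpa [hj] using this

/-- By independence only the count in `C i` changes, and the recursion `succ_mul_poissonMeasure`
applies to its factor. This recursion drives both the Mecke equation and the zero-one law. -/
lemma mul_poisson_countEvent (hP : IsPoissonPointProcess ν (fun ω : Config G => ω.1) P) {m : ℕ}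
    {C : Fin m → Set (TrajMod G)} (hC : ∀ i, BddSet (C i))
    (hd : Pairwise (Function.onFun Disjoint C)) (k : Fin m → ℕ) (i : Fin m) (hk : k i ≠ 0) :
    (k i : ℝ≥0∞) * P (countEvent C k)
      = ν (C i) * P (countEvent C (Function.update k i (k i - 1))) := by
  classical
  rw [poisson_countEvent hP hC hd, poisson_countEvent hP hC hd,
    ← Finset.mul_prod_erase _ _ (Finset.mem_univ i),
    ← Finset.mul_prod_erase Finset.univ (fun j => poissonMeasure (ν (C j)).toNNReal
      {Function.update k i (k i - 1) j}) (Finset.mem_univ i), ← mul_assoc, ← mul_assoc]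
  congr 1
  · rw [Function.update_self]
    obtain ⟨n, hn⟩ := Nat.exists_eq_succ_of_ne_zero hk
    rw [hn, Nat.succ_eq_add_one, succ_mul_poissonMeasure,
      ENNReal.coe_toNNReal (ae_ne_top_of_poisson hP (hC i))]
    rfl
  · refine Finset.prod_congr rfl fun j hj => ?_
    rw [Function.update_of_ne (Finset.ne_of_mem_erase hj)]

variable [Countable V] [Nonempty V]

/-- It suffices to compare count events for a partition that refines `D`. Inserting a point in `C i`
lowers the required count there by one, and the recursion for Poisson weights turns the total over
the parts of `D` into the factor `ω(D)`. -/
lemma mecke_bdd (hP : IsPoissonPointProcess ν (fun ω : Config G => ω.1) P)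
    {D : Set (TrajMod G)} (hD : BddSet D) :
    (P.prod (ν.restrict D)).map (fun p => addPt p.1 p.2)
      = P.withDensity (fun ω => ω.1 D) := by
  classical
  have := hP.isProbabilityMeasure
  have hfin : IsFiniteMeasure (ν.restrict D) :=
    isFiniteMeasure_restrict.2 (ae_ne_top_of_poisson hP hD)
  refine ext_of_countEvent hD fun m C hC hd ⟨I, hI⟩ k => ?_
  have hm := measurableSet_countEvent (fun i => (hC i).1) k
  rw [Measure.map_apply measurable_addPt hm, Measure.prod_apply_symm (measurable_addPt hm),
    withDensity_apply _ hm]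
  have h1 : ∀ ω ∈ countEvent C k, ω.1 D = ∑ i ∈ I, (k i : ℝ≥0∞) := by
    intro ω hω
    conv_lhs => rw [hI]
    rw [measure_biUnion_finset (fun i _ j _ hij => hd hij) fun i _ => (hC i).1]
    exact Finset.sum_congr rfl fun i _ => hω i
  rw [setLIntegral_congr_fun hm h1, setLIntegral_const, Finset.sum_mul]
  conv_lhs => rw [hI]
  rw [lintegral_biUnion_finset (s := I) (t := C) (fun i _ j _ hij => hd hij) fun i _ => (hC i).1]
  refine Finset.sum_congr rfl fun i _ => ?_
  have h2 : ∀ w ∈ C i, P ((fun ω => (ω, w)) ⁻¹' ((fun p : Config G × TrajMod G =>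
      addPt p.1 p.2) ⁻¹' countEvent C k))
      = if k i = 0 then 0 else P (countEvent C (Function.update k i (k i - 1))) := by
    intro w hw
    have : (fun ω => (ω, w)) ⁻¹' ((fun p : Config G × TrajMod G => addPt p.1 p.2) ⁻¹'
        countEvent C k)
        = {ω | k i ≠ 0 ∧ ω ∈ countEvent C (Function.update k i (k i - 1))} := by
      ext ω
      exact addPt_mem_countEvent hC hd k hw ω
    rw [this]
    by_cases h : k i = 0
    · simp [h]
    · simp [h]
  rw [setLIntegral_congr_fun (hC i).1 h2, setLIntegral_const]
  by_cases h : k i = 0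
  · simp [h]
  · rw [if_neg h, mul_poisson_countEvent hP hC hd k i h, mul_comm]

/-- The Mecke equation. -/
lemma mecke (hP : IsPoissonPointProcess ν (fun ω : Config G => ω.1) P)
    {φ : Config G → ℝ≥0∞} (hφ : Measurable φ) {r : TrajMod G → ℝ≥0∞} (hr : Measurable r) :
    ∫⁻ ω, φ ω * ∫⁻ w, r w ∂ω.1 ∂P
      = ∫⁻ w, r w * ∫⁻ ω, φ (addPt ω w) ∂P ∂ν := by
  have := hP.isProbabilityMeasure
  have := sigmaFinite_of_poisson hP
  have hφ' : Measurable fun w => ∫⁻ ω, φ (addPt ω w) ∂P :=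
    (hφ.comp measurable_addPt).lintegral_prod_left'
  have hset : ∀ D : Set (TrajMod G), BddSet D →
      ∫⁻ ω, φ ω * ω.1 D ∂P = ∫⁻ w in D, ∫⁻ ω, φ (addPt ω w) ∂P ∂ν := by
    intro D hD
    have h := congrArg (fun Q => ∫⁻ ω, φ ω ∂Q) (mecke_bdd hP hD)
    rw [lintegral_map hφ measurable_addPt,
      lintegral_prod_symm (fun p : Config G × TrajMod G => φ (addPt p.1 p.2))
        (hφ.comp measurable_addPt).aemeasurable,
      lintegral_withDensity_eq_lintegral_mul _ (measurable_apply_config G hD.1) hφ] at h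
    rw [h]
    refine lintegral_congr fun ω => ?_
    rw [Pi.mul_apply, mul_comm]
  have hval : Measurable fun ω : Config G => ω.1 := measurable_subtype_coe
  -- With `φ` fixed, both sides are measures in the remaining variable; they agree on bounded sets
  -- and hence on countable unions of cells.
  have hmeas : (P.withDensity φ).bind (fun ω => ω.1)
      = ν.withDensity fun w => ∫⁻ ω, φ (addPt ω w) ∂P := by
    obtain ⟨S, hS, hd, hU⟩ := exists_cells G
    ext D hD
    rw [measure_eq_tsum_cells hS hd hU _ hD,
      measure_eq_tsum_cells hS hd hU (ν.withDensity _) hD]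
    refine tsum_congr fun n => ?_
    have hb : BddSet (D ∩ S n) := (hS n).mono (hD.inter (hS n).1) Set.inter_subset_right
    rw [Measure.bind_apply hb.1 hval.aemeasurable, withDensity_apply _ hb.1, ← hset _ hb,
      lintegral_withDensity_eq_lintegral_mul _ hφ (measurable_apply_config G hb.1)]
    rfl
  have h := congrArg (fun μ => ∫⁻ w, r w ∂μ) hmeas
  rw [Measure.lintegral_bind hval.aemeasurable hr.aemeasurable,
    lintegral_withDensity_eq_lintegral_mul _ hφ
      (g := fun ω : Config G => ∫⁻ w, r w ∂ω.1) ((Measure.measurable_lintegral hr).comp hval),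
    lintegral_withDensity_eq_lintegral_mul _ hφ' hr] at h
  simp only [Pi.mul_apply] at h
  rw [h]
  exact lintegral_congr fun w => mul_comm _ _

/-- An event that is almost surely insensitive to the addition of a point has probability zero or
one. -/
lemma zero_one_of_addPt (hP : IsPoissonPointProcess ν (fun ω : Config G => ω.1) P)
    {E : Set (Config G)} (hE : MeasurableSet E)
    (hinv : ∀ᵐ w ∂ν, ∀ᵐ ω ∂P, addPt ω w ∈ E ↔ ω ∈ E) : P E = 0 ∨ P E = 1 := by
  classical
  have := hP.isProbabilityMeasure
  -- The claim is that `E` is independent of every event, in particular of itself.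
  have key : P.restrict E = P E • P := by
    refine ext_of_countEvent bddSet_empty fun m C hC hd _ k => ?_
    have hm := fun k => measurableSet_countEvent (fun i => (hC i).1) k
    -- Insensitivity of `E` to the inserted point makes the count probabilities intersected with `E`
    -- obey the same recursion as those of `P`.
    have hrec : ∀ (k : Fin m → ℕ) (i : Fin m), k i ≠ 0 →
        (k i : ℝ≥0∞) * P (countEvent C k ∩ E)
          = ν (C i) * P (countEvent C (Function.update k i (k i - 1)) ∩ E) := by
      intro k i hk
      have h := congrArg (fun Q => Q (countEvent C k ∩ E)) (mecke_bdd hP (hC i))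
      have hmE : MeasurableSet (countEvent C k ∩ E) := (hm k).inter hE
      have hfin : IsFiniteMeasure (ν.restrict (C i)) :=
        isFiniteMeasure_restrict.2 (ae_ne_top_of_poisson hP (hC i))
      rw [Measure.map_apply measurable_addPt hmE, Measure.prod_apply_symm (measurable_addPt hmE),
        withDensity_apply _ hmE, setLIntegral_congr_fun hmE (fun ω hω => hω.1 i),
        setLIntegral_const] at h
      rw [← h]
      have h2 : ∀ᵐ w ∂ν, w ∈ C i → P ((fun ω => (ω, w)) ⁻¹' ((fun p : Config G × TrajMod G =>
          addPt p.1 p.2) ⁻¹' (countEvent C k ∩ E)))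
          = P (countEvent C (Function.update k i (k i - 1)) ∩ E) := by
        filter_upwards [hinv] with w hw hwC
        refine measure_congr ?_
        filter_upwards [hw] with ω hω
        refine propext ?_
        change (addPt ω w ∈ countEvent C k ∧ addPt ω w ∈ E) ↔ (ω ∈ countEvent C _ ∧ ω ∈ E)
        rw [addPt_mem_countEvent hC hd k hwC, hω]
        simp [hk]
      rw [setLIntegral_congr_fun_ae (hC i).1 h2, setLIntegral_const, mul_comm]
    -- Removing points one at a time reduces both families to the void event `countEvent C 0`, so
    -- they are proportional; summing over all counts later identifies the constant as `P E`.
    have hprop : ∀ (N : ℕ) (k : Fin m → ℕ), ∑ i, k i = N →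
        P (countEvent C k ∩ E) * P (countEvent C 0)
          = P (countEvent C 0 ∩ E) * P (countEvent C k) := by
      intro N
      induction N with
      | zero =>
        intro k hk
        have : k = 0 := by
          funext i
          exact Finset.sum_eq_zero_iff.1 hk i (Finset.mem_univ i)
        rw [this]
      | succ N ih =>
        intro k hk
        obtain ⟨i, -, hi⟩ : ∃ i ∈ Finset.univ, k i ≠ 0 := by
          by_contra! h
          rw [Finset.sum_eq_zero h] at hk
          omega
        have hsum : ∑ j, Function.update k i (k i - 1) j = N := by
          rw [Finset.sum_update_of_mem (Finset.mem_univ i), ← Finset.erase_eq]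
          rw [← Finset.add_sum_erase _ _ (Finset.mem_univ i)] at hk
          omega
        have h1 := ih _ hsum
        refine (ENNReal.mul_right_inj (a := (k i : ℝ≥0∞)) (by exact_mod_cast hi) (by simp)).1 ?_
        rw [← mul_assoc, hrec k i hi, mul_assoc, h1, mul_left_comm (k i : ℝ≥0∞),
          mul_poisson_countEvent hP hC hd k i hi, mul_left_comm]
    have hcov : ⋃ κ : Fin m → ℕ, countEvent C κ = Set.univ := by
      refine Set.eq_univ_of_forall fun ω => ?_
      choose κ hκ using fun i => (hC i).exists_nat ω
      exact Set.mem_iUnion.2 ⟨κ, hκ⟩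
    have hdisj : Pairwise (Function.onFun Disjoint fun κ : Fin m → ℕ => countEvent C κ) := by
      intro κ κ' hκ
      refine Set.disjoint_left.2 fun ω hω hω' => hκ ?_
      funext i
      exact_mod_cast (hω i).symm.trans (hω' i)
    have hsumE : ∑' κ : Fin m → ℕ, P (countEvent C κ ∩ E) = P E := by
      rw [← measure_iUnion (fun i j hij => (hdisj hij).mono Set.inter_subset_left
        Set.inter_subset_left) fun κ => (hm κ).inter hE, ← Set.iUnion_inter, hcov, Set.univ_inter]
    have hsum1 : ∑' κ : Fin m → ℕ, P (countEvent C κ) = 1 := by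
      rw [← measure_iUnion hdisj hm, hcov, measure_univ]
    have h0 : P (countEvent C 0) ≠ 0 := by
      rw [poisson_countEvent hP hC hd]
      exact Finset.prod_ne_zero_iff.2 fun i _ => poissonMeasure_singleton_zero_ne _
    have hE0 : P E * P (countEvent C 0) = P (countEvent C 0 ∩ E) := by
      rw [← hsumE, ← ENNReal.tsum_mul_right, tsum_congr fun κ => hprop _ κ rfl,
        ENNReal.tsum_mul_left, hsum1, mul_one]
    rw [Measure.restrict_apply (hm k), Measure.smul_apply, smul_eq_mul]
    refine (ENNReal.mul_left_inj h0 (measure_ne_top _ _)).1 ?_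
    rw [hprop _ k rfl, ← hE0, mul_right_comm]
  have h := congrArg (fun Q => Q E) key
  simp only [Measure.restrict_apply_self, Measure.smul_apply, smul_eq_mul] at h
  by_cases h0 : P E = 0
  · exact Or.inl h0
  · right
    refine (ENNReal.mul_right_inj h0 (measure_ne_top P E)).1 ?_
    rw [mul_one]
    exact h.symm

/-- Adding an independent point of law `μ` increases the integral of a function with values in
`[0, 1]` by little if the density of `μ` with respect to the intensity has small mean
under `μ`. -/
lemma lintegral_addPt_le (hP : IsPoissonPointProcess ν (fun ω : Config G => ω.1) P)
    {μ : Measure (TrajMod G)} [IsProbabilityMeasure μ] {H : TrajMod G → ℝ≥0∞}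
    (hμ : μ ≤ ν.withDensity H) {φ : Config G → ℝ≥0∞} (hφ : Measurable φ)
    (hφ1 : ∀ ω, φ ω ≤ 1) (t : ℝ≥0) :
    4 * t * ∫⁻ ω, ∫⁻ w, φ (addPt ω w) ∂μ ∂P
      ≤ 4 * t * ∫⁻ ω, φ ω ∂P + 4 * t ^ 2 + ∫⁻ w, H w ∂μ := by
  have := hP.isProbabilityMeasure
  have := sigmaFinite_of_poisson hP
  have hac : μ ≪ ν := (Measure.absolutelyContinuous_of_le hμ).trans
    (withDensity_absolutelyContinuous ν H)
  set r := μ.rnDeriv ν with hr_def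
  have hr : Measurable r := Measure.measurable_rnDeriv μ ν
  have hμr : ν.withDensity r = μ := Measure.withDensity_rnDeriv_eq μ ν hac
  -- The true density inherits the bound `H`, so its mean under `μ` is controlled by that of `H`.
  have hrH : r ≤ᵐ[ν] H := by
    refine ae_le_of_forall_setLIntegral_le_of_sigmaFinite hr fun s hs _ => ?_
    rw [← withDensity_apply _ hs, ← withDensity_apply _ hs, hμr]
    exact hμ s
  have hint : ∀ f : TrajMod G → ℝ≥0∞, Measurable f →
      ∫⁻ w, r w * f w ∂ν = ∫⁻ w, f w ∂μ := by
    intro f hf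
    rw [← hμr, lintegral_withDensity_eq_lintegral_mul _ hr hf]
    rfl
  -- By the Mecke equation, `Y` is the density of the law of the configuration with an inserted
  -- point of law `μ`, relative to `P`.
  let Y : Config G → ℝ≥0∞ := fun ω => ∫⁻ w, r w ∂ω.1
  have hY : Measurable Y := (Measure.measurable_lintegral hr).comp measurable_subtype_coe
  have hYφ : ∀ φ : Config G → ℝ≥0∞, Measurable φ →
      ∫⁻ ω, φ ω * Y ω ∂P = ∫⁻ w, ∫⁻ ω, φ (addPt ω w) ∂P ∂μ := by
    intro φ hφ
    rw [mecke hP hφ hr]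
    exact hint (fun w => ∫⁻ ω, φ (addPt ω w) ∂P) (hφ.comp measurable_addPt).lintegral_prod_left'
  have hEY : ∫⁻ ω, Y ω ∂P = 1 := by
    have := hYφ (fun _ => 1) measurable_const
    simpa using this
  have hYadd : ∀ ω w, Y (addPt ω w) = Y ω + r w := by
    intro ω w
    simp only [Y, addPt_val]
    rw [lintegral_add_measure, lintegral_dirac' _ hr]
  -- Apply the insertion formula to `Y` itself: the inserted point adds `r w` to `Y`, so the excess
  -- of the second moment over `1` is `∫ r dμ`.
  have hEY2 : ∫⁻ ω, Y ω * Y ω ∂P ≤ 1 + ∫⁻ w, H w ∂μ := by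
    rw [hYφ Y hY]
    simp only [hYadd]
    have : ∀ w, ∫⁻ ω, (Y ω + r w) ∂P = 1 + r w := by
      intro w
      rw [lintegral_add_left hY, hEY]
      simp
    simp only [this]
    rw [lintegral_add_left measurable_const, lintegral_const, measure_univ, one_mul]
    gcongr 1 + ?_
    exact lintegral_mono_ae (hac.ae_le hrH)
  have hswap : ∫⁻ ω, ∫⁻ w, φ (addPt ω w) ∂μ ∂P = ∫⁻ ω, φ ω * Y ω ∂P := by
    rw [hYφ φ hφ]
    exact lintegral_lintegral_swap (hφ.comp measurable_addPt).aemeasurable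
  -- This expands `(2tφ - (Y - 1))² ≥ 0` and uses `φ² ≤ 1`, arranged without subtraction; it
  -- replaces Cauchy–Schwarz for the integral of `φ (Y - 1)`. After integration the two constants
  -- `2` cancel because `Y` has mean `1`.
  have hpt : ∀ ω, 4 * t * (φ ω * Y ω) + 2 * Y ω
      ≤ 4 * t * φ ω + 4 * t ^ 2 + (Y ω * Y ω + 1) := by
    intro ω
    by_cases hy : Y ω = ∞
    · rw [hy]; simp
    · lift Y ω to ℝ≥0 using hy with y
      have hf : φ ω ≠ ∞ := ((hφ1 ω).trans_lt ENNReal.one_lt_top).ne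
      have hf1 := hφ1 ω
      lift φ ω to ℝ≥0 using hf with f
      norm_cast
      rw [← NNReal.coe_le_coe]
      have hf1' : (f : ℝ) ≤ 1 := by exact_mod_cast hf1
      have hf0 : (0 : ℝ) ≤ f := f.2
      push_cast
      nlinarith [sq_nonneg (2 * (t : ℝ) * f - (y - 1)), sq_nonneg (t : ℝ),
        mul_nonneg (sq_nonneg (t : ℝ)) (sub_nonneg.2 (mul_le_one₀ hf1' hf0 hf1'))]
  have hI := lintegral_mono (μ := P) hpt
  rw [lintegral_add_right _ (hY.const_mul 2),
    lintegral_const_mul (f := fun ω => φ ω * Y ω) _ (hφ.mul hY),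
    lintegral_const_mul _ hY, hEY,
    lintegral_add_right (g := fun ω => Y ω * Y ω + 1) _ ((hY.mul hY).add_const 1),
    lintegral_add_right _ measurable_const, lintegral_const_mul _ hφ,
    lintegral_add_right _ measurable_const] at hI
  simp only [lintegral_const, measure_univ, mul_one] at hI
  rw [← hswap] at hI
  have h2 : 4 * t * ∫⁻ ω, ∫⁻ w, φ (addPt ω w) ∂μ ∂P + 2
      ≤ 4 * t * ∫⁻ ω, φ ω ∂P + 4 * t ^ 2 + ∫⁻ w, H w ∂μ + 2 := by
    calc 4 * t * ∫⁻ ω, ∫⁻ w, φ (addPt ω w) ∂μ ∂P + 2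
        ≤ 4 * t * ∫⁻ ω, φ ω ∂P + 4 * t ^ 2 + ((1 + ∫⁻ w, H w ∂μ) + 1) := by
          refine hI.trans ?_
          gcongr
      _ = _ := by ring
  exact (ENNReal.add_le_add_iff_right (by simp)).1 h2

end Mecke

/-! ### Incoming and outgoing pieces, and the exchange of pairings -/

section Traces

variable {V : Type*} {G : SimpleGraph V}

lemma isLeast_hitTime {K : Finset V} {w : Traj G} (h : Hits K w) :
    IsLeast {n : ℤ | w.1 n ∈ K} (hitTime K w) :=
  ⟨Int.csInf_mem h (visits_finite K w).bddBelow,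
    fun _ hn => csInf_le (visits_finite K w).bddBelow hn⟩

lemma isGreatest_lastTime {K : Finset V} {w : Traj G} (h : Hits K w) :
    IsGreatest {n : ℤ | w.1 n ∈ K} (lastTime K w) :=
  ⟨Int.csSup_mem h (visits_finite K w).bddAbove,
    fun _ hn => le_csSup (visits_finite K w).bddAbove hn⟩

/-- Trajectories with the same past (up to a time shift) before a visit to `K` have the same
incoming piece. -/
lemma outIn_eq {K : Finset V} {w w' : Traj G} (k : ℤ) (h0 : w'.1 0 ∈ K)
    (h : ∀ j : ℕ, w.1 (-(j : ℤ) - k) = w'.1 (-j)) : Hits K w ∧ outIn K w = outIn K w' := by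
  have hh : ∀ n : ℤ, n ≤ 0 → w.1 (n - k) = w'.1 n := by
    intro n hn
    have := h (-n).toNat
    rwa [Int.toNat_of_nonneg (by omega), neg_neg] at this
  have hle := isLeast_hitTime (w := w') ⟨0, h0⟩
  have hle0 : hitTime K w' ≤ 0 := hle.2 h0
  have hwK : w.1 (hitTime K w' - k) ∈ K := by rw [hh _ hle0]; exact hle.1
  have hτ : hitTime K w = hitTime K w' - k := by
    refine IsLeast.csInf_eq ⟨hwK, fun n hn => ?_⟩
    by_contra! hlt
    have h1 : w'.1 (n + k) ∈ K := by
      rw [← hh _ (by omega), add_sub_cancel_right]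
      exact hn
    have := hle.2 h1
    omega
  refine ⟨⟨_, hwK⟩, ?_⟩
  funext j
  rw [outIn, outIn, hτ, ← hh _ (by omega)]
  exact congrArg w.1 (by ring)

/-- Trajectories with the same future (up to a time shift) after a visit to `K` have the same
outgoing piece. -/
lemma outOut_eq {K : Finset V} {w w' : Traj G} (k : ℤ) (h0 : w'.1 0 ∈ K)
    (h : ∀ j : ℕ, w.1 ((j : ℤ) + k) = w'.1 j) : outOut K w = outOut K w' := by
  have hh : ∀ n : ℤ, 0 ≤ n → w.1 (n + k) = w'.1 n := by
    intro n hn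
    have := h n.toNat
    rwa [Int.toNat_of_nonneg hn] at this
  have hge := isGreatest_lastTime (w := w') ⟨0, h0⟩
  have hge0 : 0 ≤ lastTime K w' := hge.2 h0
  have hwK : w.1 (lastTime K w' + k) ∈ K := by rw [hh _ hge0]; exact hge.1
  have hτ : lastTime K w = lastTime K w' + k := by
    refine IsGreatest.csSup_eq ⟨hwK, fun n hn => ?_⟩
    by_contra! hlt
    have h1 : w'.1 (n - k) ∈ K := by
      rw [← hh _ (by omega), sub_add_cancel]
      exact hn
    have := hge.2 h1
    omega
  funext j
  rw [outOut, outOut, hτ, ← hh _ (by omega)]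
  exact congrArg w.1 (by ring)

variable [MeasurableSpace V] [DiscreteMeasurableSpace V] [Countable V]

lemma measurable_hitTime (K : Finset V) : Measurable (hitTime (G := G) K) := by
  classical
  refine measurable_to_countable' fun n => ?_
  have hev : ∀ m : ℤ, MeasurableSet {w : Traj G | w.1 m ∈ K} := fun m =>
    ((measurable_pi_apply m).comp measurable_subtype_coe)
      (MeasurableSet.of_discrete (s := (K : Set V)))
  -- The last part of the union accounts for trajectories avoiding `K`, whose hitting time is the
  -- infimum of the empty set, by convention `0`.
  have : hitTime (G := G) K ⁻¹' {n}
      = ({w | w.1 n ∈ K} ∩ ⋂ m : {m : ℤ // m < n}, {w | w.1 m ∈ K}ᶜ) ∪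
        ({w | Hits K w}ᶜ ∩ {_w | n = 0}) := by
    ext w
    simp only [Set.mem_preimage, Set.mem_singleton_iff, Set.mem_union, Set.mem_inter_iff,
      Set.mem_ofPred_eq, Set.mem_iInter, Set.mem_compl_iff, Subtype.forall]
    constructor
    · rintro rfl
      by_cases h : Hits K w
      · exact Or.inl ⟨(isLeast_hitTime h).1, fun m hm hmK =>
          absurd ((isLeast_hitTime h).2 hmK) (not_le.2 hm)⟩
      · refine Or.inr ⟨h, ?_⟩
        have : {n : ℤ | w.1 n ∈ K} = ∅ :=
          Set.eq_empty_of_forall_notMem fun m hm => h ⟨m, hm⟩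
        rw [hitTime, this, Int.csInf_empty]
    · rintro (⟨h1, h2⟩ | ⟨h1, rfl⟩)
      · exact (isLeast_hitTime ⟨n, h1⟩).unique ⟨h1, fun m hm => not_lt.1 fun hlt => h2 m hlt hm⟩
      · have : {n : ℤ | w.1 n ∈ K} = ∅ :=
          Set.eq_empty_of_forall_notMem fun m hm => h1 ⟨m, hm⟩
        rw [hitTime, this, Int.csInf_empty]
  rw [this]
  exact ((hev n).inter (MeasurableSet.iInter fun m : {m : ℤ // m < n} => (hev m.1).compl)).union
    ((measurableSet_hits G K).compl.inter (MeasurableSet.const _))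

lemma measurable_lastTime (K : Finset V) : Measurable (lastTime (G := G) K) := by
  classical
  refine measurable_to_countable' fun n => ?_
  have hev : ∀ m : ℤ, MeasurableSet {w : Traj G | w.1 m ∈ K} := fun m =>
    ((measurable_pi_apply m).comp measurable_subtype_coe)
      (MeasurableSet.of_discrete (s := (K : Set V)))
  have : lastTime (G := G) K ⁻¹' {n}
      = ({w | w.1 n ∈ K} ∩ ⋂ m : {m : ℤ // n < m}, {w | w.1 m ∈ K}ᶜ) ∪
        ({w | Hits K w}ᶜ ∩ {_w | n = 0}) := by
    ext w
    simp only [Set.mem_preimage, Set.mem_singleton_iff, Set.mem_union, Set.mem_inter_iff,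
      Set.mem_ofPred_eq, Set.mem_iInter, Set.mem_compl_iff, Subtype.forall]
    constructor
    · rintro rfl
      by_cases h : Hits K w
      · exact Or.inl ⟨(isGreatest_lastTime h).1, fun m hm hmK =>
          absurd ((isGreatest_lastTime h).2 hmK) (not_le.2 hm)⟩
      · refine Or.inr ⟨h, ?_⟩
        have : {n : ℤ | w.1 n ∈ K} = ∅ :=
          Set.eq_empty_of_forall_notMem fun m hm => h ⟨m, hm⟩
        rw [lastTime, this, Int.csSup_empty]
    · rintro (⟨h1, h2⟩ | ⟨h1, rfl⟩)
      · exact (isGreatest_lastTime ⟨n, h1⟩).unique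
          ⟨h1, fun m hm => not_lt.1 fun hlt => h2 m hlt hm⟩
      · have : {n : ℤ | w.1 n ∈ K} = ∅ :=
          Set.eq_empty_of_forall_notMem fun m hm => h1 ⟨m, hm⟩
        rw [lastTime, this, Int.csSup_empty]
  rw [this]
  exact ((hev n).inter (MeasurableSet.iInter fun m : {m : ℤ // n < m} => (hev m.1).compl)).union
    ((measurableSet_hits G K).compl.inter (MeasurableSet.const _))

lemma measurable_eval_traj : Measurable fun q : Traj G × ℤ => q.1.1 q.2 :=
  measurable_from_prod_countable_left fun n => (measurable_pi_apply n).comp measurable_subtype_coe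

lemma measurable_tracePiecesMod (K : Finset V) : Measurable (tracePiecesMod (G := G) K) := by
  classical
  refine measurable_from_quotient.2 ?_
  change Measurable (tracePieces (G := G) K)
  have hin : Measurable (outIn (G := G) K) := measurable_pi_iff.2 fun j =>
    measurable_eval_traj.comp (measurable_id.prodMk ((measurable_hitTime K).sub_const (j : ℤ)))
  have hout : Measurable (outOut (G := G) K) := measurable_pi_iff.2 fun j =>
    measurable_eval_traj.comp (measurable_id.prodMk ((measurable_lastTime K).add_const (j : ℤ)))
  unfold tracePieces
  refine Measurable.ite (measurableSet_hits G K) ?_ ?_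
  · exact (Measure.measurable_dirac.comp (measurable_inl.comp hin)).add
      (Measure.measurable_dirac.comp (measurable_inr.comp (measurable_inl.comp hout)))
  · exact Measure.measurable_dirac.comp (measurable_inr.comp (measurable_inr.comp measurable_proj))

lemma measurable_outUnpaired (K : Finset V) : Measurable (outUnpaired (G := G) K) :=
  (Measure.measurable_bind' (measurable_tracePiecesMod K)).comp measurable_subtype_coe

lemma outUnpaired_addPt (K : Finset V) (ω : Config G) (c : TrajMod G) :
    outUnpaired K (addPt ω c) = outUnpaired K ω + tracePiecesMod K c := by
  have hm := measurable_tracePiecesMod (G := G) K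
  ext D hD
  rw [outUnpaired, outUnpaired, Measure.add_apply, Measure.bind_apply hD hm.aemeasurable,
    Measure.bind_apply hD hm.aemeasurable, addPt_val, lintegral_add_measure,
    lintegral_dirac' (f := fun c => tracePiecesMod K c D) _ ((Measure.measurable_coe hD).comp hm)]

lemma measurableSet_of_unpairedTail {E : Set (Config G)}
    (hE : MeasurableSet[unpairedTail G] E) : MeasurableSet E := by
  have h1 : MeasurableSet[MeasurableSpace.comap (outUnpaired (G := G) ∅) inferInstance] E :=
    (iInf_le (fun K : Finset V => MeasurableSpace.comap (outUnpaired (G := G) K)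
      inferInstance) ∅) E hE
  exact (measurable_outUnpaired ∅).comap_le E h1

/-- This is the only way in which non-locality is used beyond measurability: membership may be
tested through the trace outside any one finite set, chosen to suit the configurations at hand. -/
lemma mem_iff_of_outUnpaired_eq {E : Set (Config G)} (hE : MeasurableSet[unpairedTail G] E)
    (K : Finset V) {ω ω' : Config G} (h : outUnpaired K ω = outUnpaired K ω') :
    ω ∈ E ↔ ω' ∈ E := by
  have h1 : MeasurableSet[MeasurableSpace.comap (outUnpaired (G := G) K) inferInstance] E :=
    (iInf_le (fun K : Finset V => MeasurableSpace.comap (outUnpaired (G := G) K)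
      inferInstance) K) E hE
  obtain ⟨T, -, rfl⟩ := h1
  simp only [Set.mem_preimage, h]

lemma le_addPt (ω : Config G) (c : TrajMod G) : ω ≤ addPt ω c :=
  show ω.1 ≤ ω.1 + Measure.dirac c from Measure.le_add_right le_rfl

/-- Two trajectories may be replaced by those in which the pasts and futures are paired
differently. -/
lemma tracePieces_add_eq {K : Finset V} {n : ℕ} {b c α α' β β' : ℕ → V} {w w' w₁ w₂ : Traj G}
    (hw : w.1 = glue (splice n b α, splice n c β))
    (hw' : w'.1 = glue (splice n c β', splice n b α'))
    (hw₁ : w₁.1 = glue (α, α')) (hw₂ : w₂.1 = glue (β', β))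
    (h0 : splice n b α 0 = splice n c β 0) (h0' : splice n c β' 0 = splice n b α' 0)
    (hα : α 0 = α' 0) (hβ : β' 0 = β 0) (hαK : α 0 ∈ K) (hβK : β 0 ∈ K) :
    tracePieces K w + tracePieces K w' = tracePieces K w₁ + tracePieces K w₂ := by
  classical
  have h1K : w₁.1 0 ∈ K := by
    have := glue_nonpos (α, α') 0
    simp only [Nat.cast_zero, neg_zero] at this
    rwa [hw₁, this]
  have h2K : w₂.1 0 ∈ K := by
    have := glue_nonpos (β', β) 0
    simp only [Nat.cast_zero, neg_zero] at this
    rwa [hw₂, this, hβ]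
  have e1 : ∀ j : ℕ, -(j : ℤ) - n = -((n + j : ℕ) : ℤ) := fun j => by push_cast; ring
  have e2 : ∀ j : ℕ, (j : ℤ) + n = ((n + j : ℕ) : ℤ) := fun j => by push_cast; ring
  -- Beyond time `n` in either direction, `w` has the past of `w₁` and the future of `w₂`, while
  -- `w'` has the past of `w₂` and the future of `w₁`. Both branching points lie in `K`, so the
  -- differing middle parts do not affect the pieces.
  obtain ⟨hits, hin⟩ := outIn_eq (w := w) (w' := w₁) n h1K fun j => by
    rw [hw, hw₁, e1, glue_nonpos, glue_nonpos]; exact splice_add _ _ _ _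
  obtain ⟨hits', hin'⟩ := outIn_eq (w := w') (w' := w₂) n h2K fun j => by
    rw [hw', hw₂, e1, glue_nonpos, glue_nonpos]; exact splice_add _ _ _ _
  have hout := outOut_eq (w := w) (w' := w₂) n h2K fun j => by
    rw [hw, hw₂, e2, glue_nonneg _ h0, glue_nonneg _ hβ]; exact splice_add _ _ _ _
  have hout' := outOut_eq (w := w') (w' := w₁) n h1K fun j => by
    rw [hw', hw₁, e2, glue_nonneg _ h0', glue_nonneg _ hα]; exact splice_add _ _ _ _
  have hits1 : Hits K w₁ := ⟨0, h1K⟩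
  have hits2 : Hits K w₂ := ⟨0, h2K⟩
  simp only [tracePieces, hits, hits', hits1, hits2, if_true, hin, hin', hout, hout']
  abel

end Traces

lemma shiftPath_mem_goodPaths {V : Type*} {G : SimpleGraph V} {w : ℕ → V} (hw : w ∈ goodPaths G)
    (n : ℕ) : shiftPath n w ∈ goodPaths G :=
  ⟨fun i => hw.1 (n + i),
    fun x => (hw.2 x).preimage (add_right_injective n).injOn⟩

/-! ### The coupling: a walk with two independent continuations -/

section Coupling

variable {V : Type*} (G : SimpleGraph V) [G.LocallyFinite] (a : V → V → ℝ≥0)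
  [MeasurableSpace V] [DiscreteMeasurableSpace V] [Countable V]

/-- The joint law of a walk from `o` and of two walks that continue it independently from time `n`
on. -/
def forkLaw (o : V) (n : ℕ) : Measure ((ℕ → V) × ((ℕ → V) × (ℕ → V))) :=
  walkLaw G a o ⊗ₘ (((walkKernel G a).comap (fun b : ℕ → V => b n) (measurable_pi_apply n)) ×ₖ
    ((walkKernel G a).comap (fun b : ℕ → V => b n) (measurable_pi_apply n)))

instance (o : V) (n : ℕ) : IsProbabilityMeasure (forkLaw G a o n) := by
  unfold forkLaw; infer_instance

lemma lintegral_forkLaw (o : V) (n : ℕ) {f : (ℕ → V) × ((ℕ → V) × (ℕ → V)) → ℝ≥0∞}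
    (hf : Measurable f) : ∫⁻ q, f q ∂forkLaw G a o n
      = ∫⁻ b, ∫⁻ p, f (b, p) ∂pairLaw G a (b n) ∂walkLaw G a o := by
  rw [forkLaw, Measure.lintegral_compProd hf]
  simp only [Kernel.prod_apply, Kernel.comap_apply, walkKernel_apply, pairLaw]

/-- Forgetting the other continuation leaves a walk from `o`, by the Markov property at time `n`. -/
lemma map_splice_fst_forkLaw (o : V) (n : ℕ) :
    (forkLaw G a o n).map (fun q => splice n q.1 q.2.1) = walkLaw G a o := by
  have hm : Measurable fun q : (ℕ → V) × ((ℕ → V) × (ℕ → V)) => splice n q.1 q.2.1 :=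
    (measurable_splice n).comp (measurable_fst.prodMk (measurable_fst.comp measurable_snd))
  refine Measure.ext_of_lintegral _ fun f hf => ?_
  rw [lintegral_map hf hm, lintegral_forkLaw G a o n (f := fun q => f (splice n q.1 q.2.1))
    (hf.comp hm), lintegral_walkLaw_splice G a n o hf]
  refine lintegral_congr fun b => ?_
  have hb : Measurable fun α : ℕ → V => f (splice n b α) :=
    hf.comp ((measurable_splice n).comp measurable_prodMk_left)
  rw [pairLaw, lintegral_prod (fun p : (ℕ → V) × (ℕ → V) => f (splice n b p.1))
    (hb.comp measurable_fst).aemeasurable]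
  simp

lemma map_splice_snd_forkLaw (o : V) (n : ℕ) :
    (forkLaw G a o n).map (fun q => splice n q.1 q.2.2) = walkLaw G a o := by
  have hm : Measurable fun q : (ℕ → V) × ((ℕ → V) × (ℕ → V)) => splice n q.1 q.2.2 :=
    (measurable_splice n).comp (measurable_fst.prodMk (measurable_snd.comp measurable_snd))
  refine Measure.ext_of_lintegral _ fun f hf => ?_
  rw [lintegral_map hf hm, lintegral_forkLaw G a o n (f := fun q => f (splice n q.1 q.2.2))
    (hf.comp hm), lintegral_walkLaw_splice G a n o hf]
  refine lintegral_congr fun b => ?_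
  have hb : Measurable fun α : ℕ → V => f (splice n b α) :=
    hf.comp ((measurable_splice n).comp measurable_prodMk_left)
  rw [pairLaw, lintegral_prod (fun p : (ℕ → V) × (ℕ → V) => f (splice n b p.2))
    (hb.comp measurable_snd).aemeasurable]
  simp

/-- Given the position at time `n`, the two continuations are independent walks from it, which are
exactly the halves of a two-sided walk through that position. -/
lemma map_class_forkLaw (w₀ : TrajMod G) (o : V) (n : ℕ) :
    (forkLaw G a o n).map (fun q => mk w₀ (glue q.2)) = mixLaw G a w₀ o n := by
  have hm : Measurable fun q : (ℕ → V) × ((ℕ → V) × (ℕ → V)) => mk w₀ (glue q.2) :=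
    (measurable_mk_glue w₀).comp measurable_snd
  refine Measure.ext_of_lintegral _ fun f hf => ?_
  rw [lintegral_map hf hm, lintegral_forkLaw G a o n (f := fun q => f (mk w₀ (glue q.2)))
    (hf.comp hm), mixLaw, lintegral_sum_measure]
  have h1 : ∀ b : ℕ → V, ∫⁻ p, f (mk w₀ (glue p)) ∂pairLaw G a (b n)
      = (fun u => ∫⁻ c, f c ∂classLaw G a w₀ u) (b n) := by
    intro b
    simp only [classLaw]
    rw [lintegral_map hf (measurable_mk_glue w₀)]
  simp only [h1]
  rw [← lintegral_map (f := fun u => ∫⁻ c, f c ∂classLaw G a w₀ u) Measurable.of_discrete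
    (measurable_pi_apply n), lintegral_countable']
  refine tsum_congr fun u => ?_
  rw [lintegral_smul_measure, smul_eq_mul, mul_comm,
    Measure.map_apply (measurable_pi_apply n) (measurableSet_singleton u)]
  rfl

lemma ae_forkLaw (hgood : ∀ x, ∀ᵐ w ∂walkLaw G a x, w ∈ goodPaths G) (o : V) (n : ℕ) :
    ∀ᵐ q ∂forkLaw G a o n, (q.2.1 0 = q.2.2 0 ∧ q.2.1 ∈ goodPaths G ∧ q.2.2 ∈ goodPaths G) ∧
      (splice n q.1 q.2.1 0 = o ∧ splice n q.1 q.2.1 ∈ goodPaths G) ∧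
      (splice n q.1 q.2.2 0 = o ∧ splice n q.1 q.2.2 ∈ goodPaths G) := by
  have hw : ∀ᵐ w ∂walkLaw G a o, w 0 = o ∧ w ∈ goodPaths G :=
    (ae_walkLaw_zero G a o).and (hgood o)
  have h2 : ∀ᵐ q ∂forkLaw G a o n, splice n q.1 q.2.1 0 = o ∧ splice n q.1 q.2.1 ∈ goodPaths G := by
    rw [← map_splice_fst_forkLaw G a o n] at hw
    exact ae_of_ae_map ((measurable_splice n).comp
      (measurable_fst.prodMk (measurable_fst.comp measurable_snd))).aemeasurable hw
  have hw' : ∀ᵐ w ∂walkLaw G a o, w 0 = o ∧ w ∈ goodPaths G :=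
    (ae_walkLaw_zero G a o).and (hgood o)
  have h3 : ∀ᵐ q ∂forkLaw G a o n, splice n q.1 q.2.2 0 = o ∧ splice n q.1 q.2.2 ∈ goodPaths G := by
    rw [← map_splice_snd_forkLaw G a o n] at hw'
    exact ae_of_ae_map ((measurable_splice n).comp
      (measurable_fst.prodMk (measurable_snd.comp measurable_snd))).aemeasurable hw'
  have h1 : ∀ᵐ q ∂forkLaw G a o n,
      q.2.1 0 = q.2.2 0 ∧ q.2.1 ∈ goodPaths G ∧ q.2.2 ∈ goodPaths G := by
    have : ∀ x, ∀ᵐ p ∂pairLaw G a x,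
        p.1 0 = p.2 0 ∧ p.1 ∈ goodPaths G ∧ p.2 ∈ goodPaths G := by
      intro x
      filter_upwards [ae_pairLaw G a ((ae_walkLaw_zero G a x).and (hgood x))] with p hp
      exact ⟨hp.1.1.trans hp.2.1.symm, hp.1.2, hp.2.2⟩
    have h0 : ∀ᵐ q ∂forkLaw G a o n, q.2.1 0 = q.2.2 0 := by
      refine Measure.ae_compProd_of_ae_ae (measurableSet_eq_fun (by fun_prop) (by fun_prop)) ?_
      refine ae_of_all _ fun b => ?_
      simp only [Kernel.prod_apply, Kernel.comap_apply, walkKernel_apply]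
      exact (this (b n)).mono fun p hp => hp.1
    -- The continuations are tails of the spliced paths and inherit their properties.
    filter_upwards [h0, h2, h3] with q hq hq2 hq3
    refine ⟨hq, ?_, ?_⟩
    · rw [← shiftPath_splice n q.1 q.2.1]
      exact shiftPath_mem_goodPaths hq2.2 n
    · rw [← shiftPath_splice n q.1 q.2.2]
      exact shiftPath_mem_goodPaths hq3.2 n
  filter_upwards [h1, h2, h3] with q hq1 hq2 hq3 using ⟨hq1, hq2, hq3⟩

end Coupling

/-! ### Far trajectories are undetectable, and the zero-one law -/

section Main

variable {V : Type*} {G : SimpleGraph V} [G.LocallyFinite] {a : V → V → ℝ≥0}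
  [MeasurableSpace V] [DiscreteMeasurableSpace V] [Countable V]

/-- Replacing a trajectory through `o` by two independent trajectories far away. -/
lemma lintegral_classLaw_le (hgood : ∀ x, ∀ᵐ w ∂walkLaw G a x, w ∈ goodPaths G)
    (w₀ : TrajMod G) {E : Set (Config G)} (hE : MeasurableSet[unpairedTail G] E)
    (hE_incr : IsUpperSet E) (ω : Config G) (o : V) (n : ℕ) :
    ∫⁻ c, E.indicator 1 (addPt ω c) ∂classLaw G a w₀ o
      ≤ ∫⁻ c₁, ∫⁻ c₂, E.indicator 1 (addPt (addPt ω c₁) c₂) ∂mixLaw G a w₀ o n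
        ∂mixLaw G a w₀ o n := by
  classical
  have hEm := measurableSet_of_unpairedTail hE
  set Q := forkLaw G a o n with hQ
  have hs1 : Measurable fun q : (ℕ → V) × ((ℕ → V) × (ℕ → V)) => splice n q.1 q.2.1 :=
    (measurable_splice n).comp (measurable_fst.prodMk (measurable_fst.comp measurable_snd))
  have hs2 : Measurable fun q : (ℕ → V) × ((ℕ → V) × (ℕ → V)) => splice n q.1 q.2.2 :=
    (measurable_splice n).comp (measurable_fst.prodMk (measurable_snd.comp measurable_snd))
  have hcl : Measurable fun q : (ℕ → V) × ((ℕ → V) × (ℕ → V)) => mk w₀ (glue q.2) :=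
    (measurable_mk_glue w₀).comp measurable_snd
  have hind : Measurable (E.indicator (1 : Config G → ℝ≥0∞)) := measurable_one.indicator hEm
  have hadd2 : Measurable fun p : TrajMod G × TrajMod G => addPt (addPt ω p.1) p.2 :=
    measurable_addPt.comp ((measurable_addPt.comp
      (measurable_const.prodMk measurable_fst)).prodMk measurable_snd)
  have hadd1 : Measurable fun c : TrajMod G => addPt ω c :=
    measurable_addPt.comp (measurable_const.prodMk measurable_id)
  -- Two independent forks supply the halves: the past of the walk through `o` uses the first branch
  -- of one fork, and its future the second branch of the other.
  have hL : ∫⁻ c, E.indicator 1 (addPt ω c) ∂classLaw G a w₀ o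
      = ∫⁻ r, E.indicator 1 (addPt ω (mk w₀ (glue (splice n r.1.1 r.1.2.1,
          splice n r.2.1 r.2.2.2)))) ∂Q.prod Q := by
    have : (Q.prod Q).map (Prod.map (fun q => splice n q.1 q.2.1) (fun q => splice n q.1 q.2.2))
        = pairLaw G a o := by
      rw [← Measure.map_prod_map _ _ hs1 hs2, hQ, map_splice_fst_forkLaw,
        map_splice_snd_forkLaw, pairLaw]
    rw [classLaw, lintegral_map (f := fun c => E.indicator (1 : Config G → ℝ≥0∞) (addPt ω c))
        (hind.comp hadd1) (measurable_mk_glue w₀), ← this,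
      lintegral_map (f := fun p => E.indicator (1 : Config G → ℝ≥0∞)
        (addPt ω (mk w₀ (glue p)))) ((hind.comp hadd1).comp (measurable_mk_glue w₀))
        (hs1.prodMap hs2)]
    rfl
  -- The same two forks, now joining the two branches of each fork to one another; the results are
  -- independent of law `mixLaw`.
  have hR : ∫⁻ c₁, ∫⁻ c₂, E.indicator 1 (addPt (addPt ω c₁) c₂) ∂mixLaw G a w₀ o n
        ∂mixLaw G a w₀ o n
      = ∫⁻ r, E.indicator 1 (addPt (addPt ω (mk w₀ (glue r.1.2))) (mk w₀ (glue r.2.2)))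
          ∂Q.prod Q := by
    rw [← lintegral_prod (fun p : TrajMod G × TrajMod G =>
        E.indicator (1 : Config G → ℝ≥0∞) (addPt (addPt ω p.1) p.2))
        (hind.comp hadd2).aemeasurable, ← map_class_forkLaw, Measure.map_prod_map _ _ hcl hcl,
      lintegral_map (f := fun p : TrajMod G × TrajMod G =>
        E.indicator (1 : Config G → ℝ≥0∞) (addPt (addPt ω p.1) p.2)) (hind.comp hadd2)
        (hcl.prodMap hcl)]
    rfl
  rw [hL, hR]
  have hae : ∀ᵐ r ∂Q.prod Q, _ ∧ _ :=
    (Measure.quasiMeasurePreserving_fst.ae (ae_forkLaw G a hgood o n)).and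
      (Measure.quasiMeasurePreserving_snd.ae (ae_forkLaw G a hgood o n))
  refine lintegral_mono_ae ?_
  filter_upwards [hae] with ⟨⟨b, α, α'⟩, ⟨c, β', β⟩⟩ h
  obtain ⟨⟨⟨h1, hα, hα'⟩, ⟨h2, hbα⟩, h3, hbα'⟩, ⟨h4, hβ', hβ⟩, ⟨h5, hcβ'⟩, h6, hcβ⟩ := h
  dsimp only at h1 hα hα' h2 hbα h3 hbα' h4 hβ' hβ h5 hcβ' h6 hcβ ⊢
  have m := glue_mem_trajSet (p := (splice n b α, splice n c β)) (h2.trans h6.symm) hbα hcβ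
  have m' := glue_mem_trajSet (p := (splice n c β', splice n b α')) (h5.trans h3.symm) hcβ' hbα'
  have m₁ := glue_mem_trajSet (p := (α, α')) h1 hα hα'
  have m₂ := glue_mem_trajSet (p := (β', β)) h4 hβ' hβ
  rw [mk_of_mem w₀ m, mk_of_mem w₀ m₁, mk_of_mem w₀ m₂]
  by_cases hmem : addPt ω (proj ⟨_, m⟩) ∈ E
  · have h7 : addPt (addPt ω (proj ⟨_, m⟩)) (proj ⟨_, m'⟩) ∈ E := hE_incr (le_addPt _ _) hmem
    have h8 : addPt (addPt ω (proj ⟨_, m₁⟩)) (proj ⟨_, m₂⟩) ∈ E := by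
      -- The finite set consists of the two branching points, which depend on the sample; this is
      -- allowed since `E` is measurable for the trace outside every finite set.
      refine (mem_iff_of_outUnpaired_eq hE {α 0, β 0} ?_).1 h7
      simp only [outUnpaired_addPt, add_assoc]
      congr 1
      exact tracePieces_add_eq (w := ⟨_, m⟩) (w' := ⟨_, m'⟩) (w₁ := ⟨_, m₁⟩) (w₂ := ⟨_, m₂⟩)
        rfl rfl rfl rfl (h2.trans h6.symm) (h5.trans h3.symm) h1 h4 (by simp) (by simp)
    rw [Set.indicator_of_mem hmem, Set.indicator_of_mem h8]
    rfl
  · rw [Set.indicator_of_notMem hmem]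
    exact zero_le

/-- Adding a trajectory through `o` does not increase the probability of an increasing event which
forgets the pairing. -/
lemma lintegral_classLaw_addPt_le {P : Measure (Config G)} (hP : IsInterlacementLaw G a P)
    (ha_symm : ∀ x y, a x y = a y x) (ha : ∀ x, totalWeight G a x ≠ 0)
    (hgood : ∀ x, ∀ᵐ w ∂walkLaw G a x, w ∈ goodPaths G)
    (w₀ : TrajMod G) {E : Set (Config G)} (hE : MeasurableSet[unpairedTail G] E)
    (hE_incr : IsUpperSet E) (o : V) (hgreen : green G a o o ≠ ∞) :
    ∫⁻ ω, ∫⁻ c, E.indicator 1 (addPt ω c) ∂classLaw G a w₀ o ∂P ≤ P E := by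
  have : Nonempty V := ⟨o⟩
  have := hP.isProbabilityMeasure
  have hEm := measurableSet_of_unpairedTail hE
  have hind : Measurable (E.indicator (1 : Config G → ℝ≥0∞)) := measurable_one.indicator hEm
  have hind1 : ∀ ω, E.indicator (1 : Config G → ℝ≥0∞) ω ≤ 1 := fun ω =>
    Set.indicator_le_self' (fun _ _ => zero_le) ω
  set A := ∫⁻ ω, ∫⁻ c, E.indicator 1 (addPt ω c) ∂classLaw G a w₀ o ∂P with hA
  have step1 : ∀ (t : ℝ≥0) (n : ℕ), 4 * t * A ≤ 4 * t * P E + 4 * t ^ 2 + 4 * t ^ 2 +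
      2 * ∫⁻ w, mixDensity G a o n w ∂mixLaw G a w₀ o n := by
    intro t n
    have hle := mixLaw_le ha_symm ha hgood w₀ o n
    set μ := mixLaw G a w₀ o n
    set φ : Config G → ℝ≥0∞ := fun ω => ∫⁻ c, E.indicator 1 (addPt ω c) ∂μ with hφ
    have hφm : Measurable φ :=
      Measurable.lintegral_prod_right' (f := fun p : Config G × TrajMod G =>
        E.indicator (1 : Config G → ℝ≥0∞) (addPt p.1 p.2)) (hind.comp measurable_addPt)
    have hφ1 : ∀ ω, φ ω ≤ 1 := fun ω =>
      (lintegral_mono fun c => hind1 (addPt ω c)).trans (by simp)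
    -- The two far trajectories are removed one after the other: first from the averaged indicator
    -- `φ`, then from the indicator of `E`.
    have e1 := lintegral_addPt_le hP hle hφm hφ1 t
    have e2 := lintegral_addPt_le hP hle hind hind1 t
    rw [lintegral_indicator_one hEm] at e2
    have e0 : A ≤ ∫⁻ ω, ∫⁻ c, φ (addPt ω c) ∂μ ∂P :=
      lintegral_mono fun ω => lintegral_classLaw_le hgood w₀ hE hE_incr ω o n
    calc 4 * t * A ≤ 4 * t * ∫⁻ ω, ∫⁻ c, φ (addPt ω c) ∂μ ∂P := by gcongr
      _ ≤ _ := e1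
      _ ≤ (4 * t * P E + 4 * t ^ 2 + ∫⁻ w, mixDensity G a o n w ∂μ) + 4 * t ^ 2
          + ∫⁻ w, mixDensity G a o n w ∂μ := by gcongr
      _ = _ := by ring
  have step2 : ∀ t : ℝ≥0, 4 * t * A ≤ 4 * t * P E + 4 * t ^ 2 + 4 * t ^ 2 := by
    intro t
    have hlim := tendsto_lintegral_mixDensity ha hgood w₀ o hgreen
    have h2 := ENNReal.Tendsto.const_mul (a := 2) hlim (Or.inr (by simp))
    have h3 := h2.const_add (4 * t * P E + 4 * t ^ 2 + 4 * t ^ 2 : ℝ≥0∞)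
    rw [mul_zero, add_zero] at h3
    exact ge_of_tendsto' h3 fun n => step1 t n
  refine ENNReal.le_of_forall_pos_le_add fun ε hε _ => ?_
  -- The two errors add up to `8t²`, that is `2t` after division by `4t`; hence `t = ε / 2`.
  have h := step2 (ε / 2)
  have h4 : (4 * ((ε / 2 : ℝ≥0) : ℝ≥0∞)) ≠ 0 := by
    have : ((ε / 2 : ℝ≥0) : ℝ≥0∞) ≠ 0 := by exact_mod_cast (half_pos hε).ne'
    exact mul_ne_zero (by norm_num) this
  have h4' : (4 * ((ε / 2 : ℝ≥0) : ℝ≥0∞)) ≠ ∞ := ENNReal.mul_ne_top (by simp) ENNReal.coe_ne_top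
  refine (ENNReal.mul_le_mul_iff_right h4 h4').1 (h.trans (le_of_eq ?_))
  have h5 : (ε : ℝ≥0∞) = 2 * ((ε / 2 : ℝ≥0) : ℝ≥0∞) := by
    have : ε = 2 * (ε / 2) := by field_simp
    exact_mod_cast this
  rw [h5]
  ring

lemma zero_one_of_unpairedTail (hG : G.Connected) (ha_symm : ∀ x y, a x y = a y x)
    (ha_pos : ∀ x y, G.Adj x y → 0 < a x y) (htrans : IsTransient G a)
    {P : Measure (Config G)} (hP : IsInterlacementLaw G a P) {E : Set (Config G)}
    (hE : MeasurableSet[unpairedTail G] E) (hE_incr : IsUpperSet E) : P E = 0 ∨ P E = 1 := by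
  have := hG.nonempty
  have := hP.isProbabilityMeasure
  have ha := htrans.totalWeight_ne_zero hG ha_pos
  have hgood := htrans.ae_mem_goodPaths hG ha_pos
  have hEm := measurableSet_of_unpairedTail hE
  obtain ⟨p, hp, -⟩ := (ae_glue_mem_trajSet hgood hG.nonempty.some).exists
  set w₀ : TrajMod G := proj ⟨_, hp⟩
  have hM : MeasurableSet {p : Config G × TrajMod G | addPt p.1 p.2 ∈ E} := measurable_addPt hEm
  have hN : MeasurableSet {p : Config G × TrajMod G | addPt p.1 p.2 ∈ E ∧ p.1 ∉ E} :=
    hM.inter (measurable_fst hEm).compl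
  -- The event that `E` holds after the insertion contains the event that it holds before, and has
  -- no larger probability, so the difference is null.
  have hzero : ∀ o, ∀ᵐ c ∂classLaw G a w₀ o, P {ω | addPt ω c ∈ E ∧ ω ∉ E} = 0 := by
    intro o
    have h1 := lintegral_classLaw_addPt_le hP ha_symm ha hgood w₀ hE hE_incr o
      (htrans.green_ne_top hG ha_pos o o)
    have h2 : (P.prod (classLaw G a w₀ o)) {p | addPt p.1 p.2 ∈ E} ≤ P E := by
      rw [Measure.prod_apply hM]
      refine le_of_eq_of_le (lintegral_congr fun ω => ?_) h1
      rw [← lintegral_indicator_one (measurable_prodMk_left hM)]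
      rfl
    have h3 : (P.prod (classLaw G a w₀ o)) {p | addPt p.1 p.2 ∈ E ∧ p.1 ∉ E} = 0 := by
      have h4 : (P.prod (classLaw G a w₀ o)) (Prod.fst ⁻¹' E) = P E := by
        rw [← Set.prod_univ, Measure.prod_prod, measure_univ, mul_one]
      have h5 : {p : Config G × TrajMod G | addPt p.1 p.2 ∈ E ∧ p.1 ∉ E}
          = {p | addPt p.1 p.2 ∈ E} \ Prod.fst ⁻¹' E := rfl
      have h6 : Prod.fst ⁻¹' E ⊆ {p : Config G × TrajMod G | addPt p.1 p.2 ∈ E} :=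
        fun p hp => hE_incr (le_addPt p.1 p.2) hp
      rw [h5, measure_sdiff h6 (measurable_fst hEm :).nullMeasurableSet (measure_ne_top _ _), h4]
      exact tsub_eq_zero_of_le h2
    rw [Measure.prod_apply_symm hN,
      lintegral_eq_zero_iff (measurable_measure_prodMk_right hN)] at h3
    exact h3
  have hmeas : Measurable fun c : TrajMod G => P {ω | addPt ω c ∈ E ∧ ω ∉ E} :=
    measurable_measure_prodMk_right hN
  have hnu : nu G a {c | P {ω | addPt ω c ∈ E ∧ ω ∉ E} = 0}ᶜ = 0 :=
    nu_eq_zero w₀ (hmeas (measurableSet_singleton 0)).compl fun o => hzero o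
  refine zero_one_of_addPt hP hEm ?_
  filter_upwards [mem_ae_iff.2 hnu] with c hc
  have hc' : ∀ᵐ ω ∂P, ¬ (addPt ω c ∈ E ∧ ω ∉ E) := by
    rw [ae_iff]
    simpa only [not_not] using! hc
  filter_upwards [hc'] with ω hω
  exact ⟨fun h => by_contra fun h' => hω ⟨h, h'⟩, fun h => hE_incr (le_addPt _ _) h⟩

end Main

end

end Interlacement

theorem mainTheorem1 {V : Type*} [Countable V] [MeasurableSpace V] [DiscreteMeasurableSpace V]
    (G : SimpleGraph V) [G.LocallyFinite] (hG : G.Connected)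
    (a : V → V → ℝ≥0) (ha_symm : ∀ x y, a x y = a y x) (ha_pos : ∀ x y, G.Adj x y → 0 < a x y)
    (htrans : Interlacement.IsTransient G a)
    (P : Measure (Interlacement.Config G)) (hP : Interlacement.IsInterlacementLaw G a P)
    (E : Set (Interlacement.Config G))
    (hE : MeasurableSet[Interlacement.unpairedTail G] E) (hE_incr : IsUpperSet E) :
    P E = 0 ∨ P E = 1 :=
  Interlacement.zero_one_of_unpairedTail hG ha_symm ha_pos htrans hP hE hE_incr
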